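/- A complex product structure on a smooth manifold $M$ is a pair $(P,J)$ of smooth fibrewise linear maps $TM\to TM$ (over the identity of $M$) such that $P^2=1$, $P$ has constant trace, $J^2=-1$, $PJ=-JP$, and for all smooth vector fields $X,Y$ on $M$ $$[PX,PY]+[X,Y]-P[PX,Y]-P[X,PY]=0,\qquad [JX,JY]-[X,Y]-J[JX,Y]-J[X,JY]=0 .$$ A complex product structure on a real Lie algebra $\mathfrak g$ is a pair of real linear maps $P_0,J_0:\mathfrak g\to\mathfrak g$ satisfying $P_0^2=1$, $J_0^2=-1$, $P_0J_0=-J_0P_0$ and the same two identities for all $X,Y\in\mathfrak g$. A complex product structure on a real Lie group is called homogeneous (left-invariant) if $P$ and $J$ commute with the differentials of all left translations. For every integer $m>1$, the real Lie group underlying $SL(2m-1,\mathbb C)$ admits homogeneous complex product structures. More precisely, let $\mathfrak g$ be either of the real forms $\mathfrak{sl}(2m-1,\mathbb R)$ and $\mathfrak{su}(m,m-1)$ of $\mathfrak{sl}(2m-1,\mathbb C)$. Then there are a complex product structure $(P_0,J_0)$ on the real Lie algebra $\mathfrak g$ and a left-invariant complex product structure $(P,J)$ on the real Lie group underlying $SL(2m-1,\mathbb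 C)$ such that, on the tangent space $\mathfrak{sl}(2m-1,\mathbb C)=\mathfrak g\oplus i\mathfrak g$ at the identity, $P$ and $J$ are the $\mathbb C$-linear extensions of $P_0$ and $J_0$: $$P(X+iY)=P_0X+iP_0Y,\qquad J(X+iY)=J_0X+iJ_0Y\qquad(X,Y\in\mathfrak g).$$ -/

import Mathlib

open scoped Manifold ContDiff

attribute [local instance 100] LieRing.ofAssociativeRing

noncomputable section

/-! ### Complex product structures on manifolds -/

section ManifoldStructures

variable {E : Type*} [NormedAddCommGroup E] [NormedSpace ℝ E]
  {H : Type*} [TopologicalSpace H] (I : ModelWithCorners ℝ E H)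
  (M : Type*) [TopologicalSpace M] [ChartedSpace H M]

/-- A fibrewise linear map `TM → TM` over the identity of `M` (no smoothness yet). -/
abbrev TangentEndo : Type _ := ∀ x : M, TangentSpace I x →L[ℝ] TangentSpace I x

variable {I M} [IsManifold I 1 M]

/-- `A` is smooth as a map from the total space `TM` to itself. -/
def TangentEndo.IsSmooth (A : TangentEndo I M) : Prop :=
  ContMDiff I.tangent I.tangent ∞
    (fun v : TangentBundle I M => (⟨v.1, A v.1 v.2⟩ : TangentBundle I M))

/-- `X` is a smooth vector field, i.e. a smooth section of `TM → M`. -/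
def IsSmoothVectorField (X : ∀ x : M, TangentSpace I x) : Prop :=
  ContMDiff I I.tangent ∞ (fun x : M => (⟨x, X x⟩ : TangentBundle I M))

/-- `[A X, A Y] + ε [X, Y] - A [A X, Y] - A [X, A Y]` at `x`. It is the Nijenhuis expression of
an almost product structure for `ε = 1` and of an almost complex structure for `ε = -1`. -/
def TangentEndo.nijenhuis (A : TangentEndo I M) (ε : ℝ) (X Y : ∀ x : M, TangentSpace I x)
    (x : M) : TangentSpace I x :=
  VectorField.mlieBracket I (fun y => A y (X y)) (fun y => A y (Y y)) x
    + ε • VectorField.mlieBracket I X Y x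
    - A x (VectorField.mlieBracket I (fun y => A y (X y)) Y x)
    - A x (VectorField.mlieBracket I X (fun y => A y (Y y)) x)

/-- A product structure: a smooth fibrewise linear involution of `TM`, of constant trace, whose
Nijenhuis expression vanishes on all pairs of smooth vector fields. -/
structure IsProductStructure (P : TangentEndo I M) : Prop where
  smooth : P.IsSmooth
  sq : ∀ (x : M) (v : TangentSpace I x), P x (P x v) = v
  trace_const : ∃ c : ℝ, ∀ x : M,
    LinearMap.trace ℝ (TangentSpace I x) (P x : TangentSpace I x →ₗ[ℝ] TangentSpace I x) = c
  integrable : ∀ X Y : (∀ x : M, TangentSpace I x), IsSmoothVectorField X →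
    IsSmoothVectorField Y → ∀ x : M, P.nijenhuis 1 X Y x = 0

/-- A complex structure: a smooth fibrewise linear `J : TM → TM` with `J² = -1` whose Nijenhuis
expression vanishes on all pairs of smooth vector fields. -/
structure IsComplexStructure (J : TangentEndo I M) : Prop where
  smooth : J.IsSmooth
  sq : ∀ (x : M) (v : TangentSpace I x), J x (J x v) = -v
  integrable : ∀ X Y : (∀ x : M, TangentSpace I x), IsSmoothVectorField X →
    IsSmoothVectorField Y → ∀ x : M, J.nijenhuis (-1) X Y x = 0

/-- A complex product structure: a product structure and a complex structure that anticommute. -/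
structure IsComplexProductStructure (P J : TangentEndo I M) : Prop where
  product : IsProductStructure P
  complex : IsComplexStructure J
  anticomm : ∀ (x : M) (v : TangentSpace I x), P x (J x v) = -J x (P x v)

end ManifoldStructures

/-- `A` is invariant under all left translations `L_g` of `G`: `dL_g ∘ A = A ∘ dL_g`. -/
def TangentEndo.IsLeftInvariant {E : Type*} [NormedAddCommGroup E] [NormedSpace ℝ E]
    {H : Type*} [TopologicalSpace H] {I : ModelWithCorners ℝ E H}
    {G : Type*} [TopologicalSpace G] [ChartedSpace H G] [Group G]
    (A : TangentEndo I G) : Prop :=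
  ∀ (g x : G) (v : TangentSpace I x),
    mfderiv I I (fun y : G => g * y) x (A x v) = A (g * x) (mfderiv I I (fun y : G => g * y) x v)

/-- A complex product structure on a real Lie algebra `L`. -/
structure IsLieComplexProductStructure {L : Type*} [LieRing L] [LieAlgebra ℝ L]
    (P J : L →ₗ[ℝ] L) : Prop where
  product_sq : ∀ X, P (P X) = X
  complex_sq : ∀ X, J (J X) = -X
  anticomm : ∀ X, P (J X) = -J (P X)
  product_integrable : ∀ X Y, ⁅P X, P Y⁆ + ⁅X, Y⁆ - P ⁅P X, Y⁆ - P ⁅X, P Y⁆ = 0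
  complex_integrable : ∀ X Y, ⁅J X, J Y⁆ - ⁅X, Y⁆ - J ⁅J X, Y⁆ - J ⁅X, J Y⁆ = 0

/-! ### The real forms `sl(n, ℝ)` and `su(p, n - p)` inside the complex matrices -/

/-- `sl(n, ℝ)`: complex `n × n` matrices with real entries and trace zero. -/
def slReal (n : ℕ) : LieSubalgebra ℝ (Matrix (Fin n) (Fin n) ℂ) where
  carrier := {A | A.map (starRingEnd ℂ) = A ∧ A.trace = 0}
  add_mem' := by
    rintro A B ⟨hA, hA'⟩ ⟨hB, hB'⟩
    refine ⟨?_, by rw [Matrix.trace_add, hA', hB', add_zero]⟩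
    rw [Matrix.map_add _ (map_add _), hA, hB]
  zero_mem' := ⟨by ext; simp, by simp⟩
  smul_mem' := by
    rintro c A ⟨hA, hA'⟩
    refine ⟨?_, by rw [Matrix.trace_smul, hA', smul_zero]⟩
    ext i j
    have := congrFun (congrFun hA i) j
    simp only [Matrix.map_apply] at this
    simp [this]
  lie_mem' := by
    rintro A B ⟨hA, -⟩ ⟨hB, -⟩
    refine ⟨?_, by rw [Ring.lie_def, Matrix.trace_sub, Matrix.trace_mul_comm, sub_self]⟩
    rw [Ring.lie_def, Matrix.map_sub _ (map_sub _), Matrix.map_mul, Matrix.map_mul, hA, hB]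

/-- The diagonal matrix with entries `1` (`p` times) and then `-1`, of size `n ≥ p`. -/
def signatureMatrix (n p : ℕ) : Matrix (Fin n) (Fin n) ℂ :=
  Matrix.diagonal fun i => if (i : ℕ) < p then 1 else -1

/-- `su(p, n - p)`: complex `n × n` matrices of trace zero that are skew for the Hermitian form
with matrix `signatureMatrix n p`. -/
def suIndefinite (n p : ℕ) : LieSubalgebra ℝ (Matrix (Fin n) (Fin n) ℂ) where
  carrier := {A | A.conjTranspose * signatureMatrix n p + signatureMatrix n p * A = 0 ∧
    A.trace = 0}
  add_mem' := by
    rintro A B ⟨hA, hA'⟩ ⟨hB, hB'⟩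
    refine ⟨?_, by rw [Matrix.trace_add, hA', hB', add_zero]⟩
    rw [Matrix.conjTranspose_add, add_mul, mul_add, add_add_add_comm, hA, hB, add_zero]
  zero_mem' := ⟨by simp, by simp⟩
  smul_mem' := by
    rintro c A ⟨hA, hA'⟩
    refine ⟨?_, by rw [Matrix.trace_smul, hA', smul_zero]⟩
    rw [Matrix.conjTranspose_smul, star_trivial, Matrix.smul_mul, Matrix.mul_smul, ← smul_add, hA,
      smul_zero]
  lie_mem' := by
    rintro A B ⟨hA, -⟩ ⟨hB, -⟩
    refine ⟨?_, by rw [Ring.lie_def, Matrix.trace_sub, Matrix.trace_mul_comm, sub_self]⟩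
    have h1 := eq_neg_of_add_eq_zero_left hA
    have h2 := eq_neg_of_add_eq_zero_left hB
    rw [Ring.lie_def, Matrix.conjTranspose_sub, Matrix.conjTranspose_mul, Matrix.conjTranspose_mul,
      sub_mul, mul_sub, mul_assoc, mul_assoc, h1, h2, mul_neg, mul_neg, ← mul_assoc, ← mul_assoc,
      h1, h2]
    noncomm_ring

/-! ### The real Lie group underlying `SL(n, ℂ)` -/

section SL

open Matrix

/-- The model space: all matrix entries except the top left one. As a real vector space it has
dimension `2 (n² - 1)` (for `n ≥ 1`). -/
abbrev SLModel (n : ℕ) : Type :=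
  {p : Fin n × Fin n // ¬((p.1 : ℕ) = 0 ∧ (p.2 : ℕ) = 0)} → ℂ

variable {n : ℕ}

/-- The matrix whose top left entry is `t` and whose other entries are given by `x`. -/
def slFill (x : SLModel n) (t : ℂ) : Matrix (Fin n) (Fin n) ℂ :=
  Matrix.of fun i j => if h : (i : ℕ) = 0 ∧ (j : ℕ) = 0 then t else x ⟨(i, j), h⟩

/-- The top left cofactor of a matrix with non-corner entries `x`: the determinant after replacing
the first row by `(1, 0, …, 0)`. -/
def slCofactor (x : SLModel n) : ℂ :=
  (Matrix.of fun i j : Fin n =>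
    if (i : ℕ) = 0 then (if (j : ℕ) = 0 then 1 else 0) else slFill x 0 i j).det

/-- The top left entry of the matrix of determinant `1` with non-corner entries `x`. -/
def slCorner (x : SLModel n) : ℂ := (1 - (slFill x 0).det) / slCofactor x

/-- The entries of a matrix except the top left one. -/
def slCoord (A : Matrix (Fin n) (Fin n) ℂ) : SLModel n := fun p => A p.1.1 p.1.2

theorem slFill_slCoord (A : Matrix (Fin n) (Fin n) ℂ) (t : ℂ)
    (h : ∀ i j : Fin n, (i : ℕ) = 0 → (j : ℕ) = 0 → A i j = t) : slFill (slCoord A) t = A := by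
  ext i j
  by_cases hij : (i : ℕ) = 0 ∧ (j : ℕ) = 0
  · simp [slFill, hij, h i j hij.1 hij.2]
  · simp [slFill, hij, slCoord]

theorem slCoord_slFill (x : SLModel n) (t : ℂ) : slCoord (slFill x t) = x := by
  ext ⟨p, hp⟩
  simp [slCoord, slFill, hp]

theorem det_slFill (x : SLModel (n + 1)) (t : ℂ) :
    (slFill x t).det = (slFill x 0).det + t * slCofactor x := by
  have e1 : slFill x t = (slFill x 0).updateRow 0
      ((slFill x 0) 0 + t • (fun j : Fin (n + 1) => if (j : ℕ) = 0 then (1 : ℂ) else 0)) := by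
    ext i j
    refine Fin.cases ?_ (fun i => ?_) i
    · refine Fin.cases ?_ (fun j => ?_) j <;> simp [slFill]
    · simp [slFill]
  have e2 : (Matrix.of fun i j : Fin (n + 1) =>
      if (i : ℕ) = 0 then (if (j : ℕ) = 0 then (1 : ℂ) else 0) else slFill x 0 i j) =
      (slFill x 0).updateRow 0 (fun j : Fin (n + 1) => if (j : ℕ) = 0 then (1 : ℂ) else 0) := by
    ext i j
    refine Fin.cases ?_ (fun i => ?_) i <;> simp
  rw [e1, det_updateRow_add, det_updateRow_smul, updateRow_eq_self, slCofactor, e2]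

theorem det_slFill_slCorner (x : SLModel n) (hx : slCofactor x ≠ 0) :
    (slFill x (slCorner x)).det = 1 := by
  cases n with
  | zero => simp
  | succ n => rw [det_slFill, slCorner, div_mul_cancel₀ _ hx, add_sub_cancel]

theorem slFill_corner (g : SpecialLinearGroup (Fin n) ℂ)
    (hg : slCofactor (slCoord (g : Matrix (Fin n) (Fin n) ℂ)) ≠ 0) :
    slFill (slCoord (g : Matrix (Fin n) (Fin n) ℂ)) (slCorner (slCoord g.1)) = g.1 := by
  cases n with
  | zero => ext i; exact i.elim0
  | succ n =>
    have h0 : slFill (slCoord g.1) (g.1 0 0) = g.1 := by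
      refine slFill_slCoord _ _ fun i j hi hj => ?_
      rw [Fin.ext (a := i) (b := 0) hi, Fin.ext (a := j) (b := 0) hj]
    have h1 := det_slFill (slCoord g.1) (g.1 0 0)
    rw [h0] at h1
    have hd : (g.1).det = 1 := g.2
    rw [hd] at h1
    have h2 : slCorner (slCoord g.1) = g.1 0 0 := by
      rw [slCorner, div_eq_iff hg]
      linear_combination h1
    rw [h2, h0]

theorem contDiff_slFill_zero (i j : Fin n) :
    ContDiff ℝ ∞ fun x : SLModel n => slFill x 0 i j := by
  by_cases h : (i : ℕ) = 0 ∧ (j : ℕ) = 0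
  · simpa [slFill, h] using contDiff_const
  · simp only [slFill, Matrix.of_apply, h, dite_false]
    exact contDiff_apply ℝ ℂ _

theorem contDiff_det_of_entries {V : Type*} [NormedAddCommGroup V] [NormedSpace ℝ V]
    {A : V → Matrix (Fin n) (Fin n) ℂ} (h : ∀ i j, ContDiff ℝ ∞ fun x => A x i j) :
    ContDiff ℝ ∞ fun x => (A x).det := by
  simp only [Matrix.det_apply]
  refine ContDiff.sum fun σ _ => ?_
  simp only [Units.smul_def, zsmul_eq_mul]
  exact contDiff_const.mul (contDiff_prod fun i _ => h _ _)

theorem contDiff_slCofactor : ContDiff ℝ ∞ (slCofactor : SLModel n → ℂ) := by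
  refine contDiff_det_of_entries fun i j => ?_
  by_cases hi : (i : ℕ) = 0
  · simpa [hi] using contDiff_const
  · simpa [hi] using contDiff_slFill_zero i j

theorem contDiffOn_slFill (i j : Fin n) :
    ContDiffOn ℝ ∞ (fun x : SLModel n => slFill x (slCorner x) i j) {x | slCofactor x ≠ 0} := by
  by_cases h : (i : ℕ) = 0 ∧ (j : ℕ) = 0
  · simp only [slFill, Matrix.of_apply, h, and_self, dite_true, slCorner, div_eq_mul_inv]
    exact ((contDiff_const.sub (contDiff_det_of_entries contDiff_slFill_zero)).contDiffOn).mul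
      (contDiff_slCofactor.contDiffOn.inv fun x hx => hx)
  · simp only [slFill, Matrix.of_apply, h, dite_false]
    exact (contDiff_apply ℝ ℂ _).contDiffOn

theorem isOpen_slCofactor : IsOpen {x : SLModel n | slCofactor x ≠ 0} :=
  isOpen_ne.preimage contDiff_slCofactor.continuous

theorem continuous_slCoord :
    Continuous fun g : SpecialLinearGroup (Fin n) ℂ => slCoord g.1 :=
  continuous_pi fun p => by
    simp only [slCoord]
    exact continuous_subtype_val.matrix_elem _ _

open Classical in
/-- The matrix of determinant `1` with non-corner entries `x`, if `slCofactor x ≠ 0`. -/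
def slOfCoord (x : SLModel n) : SpecialLinearGroup (Fin n) ℂ :=
  if hx : slCofactor x ≠ 0 then ⟨slFill x (slCorner x), det_slFill_slCorner x hx⟩ else 1

theorem slOfCoord_val {x : SLModel n} (hx : slCofactor x ≠ 0) :
    (slOfCoord x).1 = slFill x (slCorner x) := by
  have : slOfCoord x = ⟨slFill x (slCorner x), det_slFill_slCorner x hx⟩ := dif_pos hx
  rw [this]

/-- The chart of `SL(n, ℂ)` around `1`: on the open set where the top left cofactor does not
vanish, a matrix of determinant `1` is determined by its other entries. -/
def slChartOne (n : ℕ) : OpenPartialHomeomorph (SpecialLinearGroup (Fin n) ℂ) (SLModel n) where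
  toFun g := slCoord g.1
  invFun := slOfCoord
  source := {g | slCofactor (slCoord g.1) ≠ 0}
  target := {x | slCofactor x ≠ 0}
  map_source' _ hg := hg
  map_target' x hx := by
    have h : slCoord (slOfCoord x).1 = x := by rw [slOfCoord_val hx, slCoord_slFill]
    change slCofactor (slCoord (slOfCoord x).1) ≠ 0
    rw [h]
    exact hx
  left_inv' g hg := Subtype.ext ((slOfCoord_val hg).trans (slFill_corner g hg))
  right_inv' x hx := by
    rw [slOfCoord_val hx, slCoord_slFill]
  open_source := isOpen_slCofactor.preimage continuous_slCoord
  open_target := isOpen_slCofactor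
  continuousOn_toFun := continuous_slCoord.continuousOn
  continuousOn_invFun := by
    refine (SpecialLinearGroup.isClosedEmbedding_val (n := Fin n)
      (R := ℂ)).isInducing.continuousOn_iff.2 ?_
    refine continuousOn_pi.2 fun i => continuousOn_pi.2 fun j => ?_
    refine (contDiffOn_slFill i j).continuousOn.congr fun x hx => ?_
    exact congrFun (congrFun (slOfCoord_val hx) i) j

theorem slChartOne_symm_val {x : SLModel n} (hx : slCofactor x ≠ 0) :
    ((slChartOne n).symm x).1 = slFill x (slCorner x) := slOfCoord_val hx

theorem one_mem_slChartOne_source : (1 : SpecialLinearGroup (Fin n) ℂ) ∈ (slChartOne n).source := by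
  change slCofactor (slCoord (1 : Matrix (Fin n) (Fin n) ℂ)) ≠ 0
  have : slCofactor (slCoord (1 : Matrix (Fin n) (Fin n) ℂ)) = 1 := by
    have h : (Matrix.of fun i j : Fin n => if (i : ℕ) = 0 then (if (j : ℕ) = 0 then (1 : ℂ) else 0)
        else slFill (slCoord (1 : Matrix (Fin n) (Fin n) ℂ)) 0 i j) = 1 := by
      ext i j
      by_cases hi : (i : ℕ) = 0
      · simp only [hi, if_true, Matrix.of_apply, Matrix.one_apply, Fin.ext_iff, eq_comm]
      · simp [hi, slFill, slCoord]
    rw [slCofactor, h, Matrix.det_one]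
  rw [this]
  exact one_ne_zero

/-- The chart of `SL(n, ℂ)` around `g`: the left translate of the chart around `1`. -/
def slChart (g : SpecialLinearGroup (Fin n) ℂ) :
    OpenPartialHomeomorph (SpecialLinearGroup (Fin n) ℂ) (SLModel n) :=
  (Homeomorph.mulLeft g⁻¹).toOpenPartialHomeomorph ≫ₕ slChartOne n

/-- The atlas of all left translates of the chart around `1`. -/
instance : ChartedSpace (SLModel n) (SpecialLinearGroup (Fin n) ℂ) where
  atlas := Set.range slChart
  chartAt := slChart
  mem_chart_source g := by
    have : g⁻¹ * g ∈ (slChartOne n).source := by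
      rw [inv_mul_cancel]; exact one_mem_slChartOne_source
    simpa [slChart] using this
  chart_mem_atlas g := ⟨g, rfl⟩

theorem slChart_apply (g h : SpecialLinearGroup (Fin n) ℂ) :
    slChart g h = slCoord (g⁻¹ * h).1 := rfl

theorem slChart_symm_entry (g : SpecialLinearGroup (Fin n) ℂ) {x : SLModel n}
    (hx : slCofactor x ≠ 0) (i j : Fin n) :
    ((slChart g).symm x).1 i j = ∑ k, g.1 i k * slFill x (slCorner x) k j := by
  have h : (slChart g).symm x = g * (slChartOne n).symm x := by
    change (Homeomorph.mulLeft g⁻¹).symm ((slChartOne n).symm x) = _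
    rw [Homeomorph.mulLeft_symm, inv_inv]
    rfl
  rw [h, ← slChartOne_symm_val hx]
  simp [Matrix.mul_apply]

theorem slChart_target (g : SpecialLinearGroup (Fin n) ℂ) :
    (slChart g).target = {x | slCofactor x ≠ 0} := by
  simp [slChart, slChartOne]

theorem contDiffOn_slChart_symm_entry (g : SpecialLinearGroup (Fin n) ℂ) (i j : Fin n) :
    ContDiffOn ℝ ∞ (fun x : SLModel n => ((slChart g).symm x).1 i j) (slChart g).target := by
  rw [slChart_target]
  refine (ContDiffOn.sum (s := Finset.univ) fun k _ =>
    (contDiffOn_const (c := g.1 i k)).mul (contDiffOn_slFill k j)).congr fun x hx => ?_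
  exact slChart_symm_entry g hx i j

/-- `SL(n, ℂ)` is a smooth real manifold. -/
instance : IsManifold 𝓘(ℝ, SLModel n) ∞ (SpecialLinearGroup (Fin n) ℂ) := by
  refine isManifold_of_contDiffOn _ _ _ ?_
  rintro _ _ ⟨g, rfl⟩ ⟨h, rfl⟩
  simp only [modelWithCornersSelf_coe, modelWithCornersSelf_coe_symm, Function.id_comp,
    Function.comp_id, Set.preimage_id, Set.range_id, Set.inter_univ]
  refine contDiffOn_pi.2 fun p => ?_
  have : ∀ x : SLModel n, (((slChart g).symm ≫ₕ slChart h) x) p =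
      ∑ k, (h⁻¹).1 p.1.1 k * ((slChart g).symm x).1 k p.1.2 := by
    intro x
    simp only [OpenPartialHomeomorph.coe_trans, Function.comp_apply, slChart_apply, slCoord]
    exact Matrix.mul_apply
  simp only [this]
  refine ContDiffOn.sum fun k _ => contDiffOn_const.mul ?_
  exact (contDiffOn_slChart_symm_entry g k _).mono fun x hx => hx.1

theorem contMDiffAt_mul_complex {E' : Type*} [NormedAddCommGroup E'] [NormedSpace ℝ E']
    {H' : Type*} [TopologicalSpace H'] {I' : ModelWithCorners ℝ E' H'}
    {N : Type*} [TopologicalSpace N] [ChartedSpace H' N] {f g : N → ℂ} {x : N}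
    (hf : ContMDiffAt I' 𝓘(ℝ, ℂ) ∞ f x) (hg : ContMDiffAt I' 𝓘(ℝ, ℂ) ∞ g x) :
    ContMDiffAt I' 𝓘(ℝ, ℂ) ∞ (fun y => f y * g y) x :=
  ((contDiff_mul (𝕜 := ℝ) (𝔸 := ℂ) (n := ∞)).contMDiff.contMDiffAt (x := (f x, g x))).comp x
    (hf.prodMk_space hg)

/-- The matrix entries are smooth functions on `SL(n, ℂ)`. -/
theorem contMDiff_sl_entry (i j : Fin n) :
    ContMDiff 𝓘(ℝ, SLModel n) 𝓘(ℝ, ℂ) ∞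
      (fun g : SpecialLinearGroup (Fin n) ℂ => g.1 i j) := by
  intro g
  rw [contMDiffAt_iff_source]
  have hx : (slChart g) g ∈ (slChart g).target :=
    (slChart g).map_source (mem_chart_source (SLModel n) g)
  have := (contDiffOn_slChart_symm_entry g i j).contDiffAt ((slChart g).open_target.mem_nhds hx)
  exact this.contMDiffAt.contMDiffWithinAt

/-- A map into `SL(n, ℂ)` is smooth if it is continuous and its matrix entries are smooth. -/
theorem contMDiff_sl_of_entries {E' : Type*} [NormedAddCommGroup E'] [NormedSpace ℝ E']
    {H' : Type*} [TopologicalSpace H'] {I' : ModelWithCorners ℝ E' H'}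
    {N : Type*} [TopologicalSpace N] [ChartedSpace H' N]
    {f : N → SpecialLinearGroup (Fin n) ℂ} (hc : Continuous f)
    (h : ∀ i j, ContMDiff I' 𝓘(ℝ, ℂ) ∞ fun y => (f y).1 i j) :
    ContMDiff I' 𝓘(ℝ, SLModel n) ∞ f := by
  intro x
  rw [contMDiffAt_iff_target]
  refine ⟨hc.continuousAt, contMDiffAt_pi_space.2 fun p => ?_⟩
  have : ∀ y, (extChartAt 𝓘(ℝ, SLModel n) (f x) ∘ f) y p =
      ∑ k, ((f x)⁻¹).1 p.1.1 k * (f y).1 k p.1.2 := by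
    intro y
    change slCoord ((f x)⁻¹ * f y).1 p = _
    exact Matrix.mul_apply
  simp only [this]
  refine ContMDiffAt.sum fun k _ => ?_
  exact contMDiffAt_mul_complex contMDiffAt_const (h k _ x)

/-- `SL(n, ℂ)` is a real Lie group. -/
instance : LieGroup 𝓘(ℝ, SLModel n) ∞ (SpecialLinearGroup (Fin n) ℂ) where
  contMDiff_mul := by
    refine contMDiff_sl_of_entries continuous_mul fun i j => ?_
    have : ∀ y : SpecialLinearGroup (Fin n) ℂ × SpecialLinearGroup (Fin n) ℂ,
        (y.1 * y.2).1 i j = ∑ k, y.1.1 i k * y.2.1 k j := fun y => Matrix.mul_apply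
    simp only [this]
    refine ContMDiff.sum fun k _ => ?_
    exact fun y => contMDiffAt_mul_complex (((contMDiff_sl_entry i k).comp contMDiff_fst) y)
      (((contMDiff_sl_entry k j).comp contMDiff_snd) y)
  contMDiff_inv := by
    refine contMDiff_sl_of_entries continuous_inv fun i j => ?_
    have hd : ContDiff ℝ ∞ fun A : Fin n → Fin n → ℂ => (Matrix.of A).adjugate i j := by
      simp only [Matrix.adjugate_apply]
      refine contDiff_det_of_entries fun a b => ?_
      by_cases hab : a = j
      · subst hab
        simpa using contDiff_const
      · simpa [hab] using contDiff_apply_apply ℝ ℂ a b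
    have he : ContMDiff 𝓘(ℝ, SLModel n) 𝓘(ℝ, Fin n → Fin n → ℂ) ∞
        (fun g : SpecialLinearGroup (Fin n) ℂ => (fun a b => g.1 a b : Fin n → Fin n → ℂ)) :=
      contMDiff_pi_space.2 fun a => contMDiff_pi_space.2 fun b => contMDiff_sl_entry a b
    exact hd.contMDiff.comp he

/-- The matrix of a tangent vector at `1`, i.e. its image under the derivative of the inclusion of
`SL(n, ℂ)` into the space of all matrices. This identifies `T₁ SL(n, ℂ)` with `sl(n, ℂ)`. -/
def slTangentMatrix (v : TangentSpace 𝓘(ℝ, SLModel n) (1 : SpecialLinearGroup (Fin n) ℂ)) :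
    Matrix (Fin n) (Fin n) ℂ :=
  Matrix.of fun i j => (mfderiv 𝓘(ℝ, SLModel n) 𝓘(ℝ, ℂ)
    (fun g : SpecialLinearGroup (Fin n) ℂ => g.1 i j) 1 v : ℂ)

/-- At the identity, `A` is the `ℂ`-linear extension of the real linear operator `A₀` of `𝔤`:
`A (X + i Y) = A₀ X + i A₀ Y` for `X, Y ∈ 𝔤`. -/
def IsComplexLinearExtension (𝔤 : LieSubalgebra ℝ (Matrix (Fin n) (Fin n) ℂ)) (A₀ : 𝔤 →ₗ[ℝ] 𝔤)
    (A : TangentEndo 𝓘(ℝ, SLModel n) (SpecialLinearGroup (Fin n) ℂ)) : Prop :=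
  ∀ (v : TangentSpace 𝓘(ℝ, SLModel n) (1 : SpecialLinearGroup (Fin n) ℂ)) (X Y : 𝔤),
    slTangentMatrix v = (X : Matrix (Fin n) (Fin n) ℂ) + Complex.I • (Y : Matrix _ _ ℂ) →
    slTangentMatrix (A 1 v) =
      (A₀ X : Matrix (Fin n) (Fin n) ℂ) + Complex.I • (A₀ Y : Matrix (Fin n) (Fin n) ℂ)

end SL

end

noncomputable section

/-! ### Block operators on complex matrices -/

section PairOp

open Matrix

/-- If `K² = μ²` on a subspace `T` and the two eigenspaces of `K` in `T` are closed under the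
bracket, then the Nijenhuis expression of `K` vanishes on `T`. -/
theorem nijenhuis_eq_zero_of_eigenspaces {L : Type*} [LieRing L] [LieAlgebra ℂ L]
    (K : L →ₗ[ℂ] L) (T : Submodule ℂ L) {μ : ℂ} (hμ : μ ≠ 0)
    (hsq : ∀ X ∈ T, K (K X) = (μ * μ) • X)
    (hp : ∀ X Y, K X = μ • X → K Y = μ • Y → K ⁅X, Y⁆ = μ • ⁅X, Y⁆)
    (hn : ∀ X Y, K X = -μ • X → K Y = -μ • Y → K ⁅X, Y⁆ = -μ • ⁅X, Y⁆)
    {X Y : L} (hX : X ∈ T) (hY : Y ∈ T) :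
    ⁅K X, K Y⁆ + (μ * μ) • ⁅X, Y⁆ - K ⁅K X, Y⁆ - K ⁅X, K Y⁆ = 0 := by
  have key : ∀ X ∈ T, ∃ A B : L, K A = μ • A ∧ K B = -μ • B ∧ X = A + B := by
    intro X hX
    refine ⟨(1 / 2 : ℂ) • (X + μ⁻¹ • K X), (1 / 2 : ℂ) • (X - μ⁻¹ • K X), ?_, ?_, ?_⟩
    · rw [map_smul, map_add, map_smul, hsq X hX]
      match_scalars <;> field_simp
    · rw [map_smul, map_sub, map_smul, hsq X hX]
      match_scalars <;> field_simp
    · module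
  obtain ⟨A, B, hA, hB, rfl⟩ := key X hX
  obtain ⟨C, D, hC, hD, rfl⟩ := key Y hY
  have h1 := hp A C hA hC
  have h2 := hn B D hB hD
  simp only [map_add, hA, hB, hC, hD, lie_add, add_lie, lie_smul, smul_lie, map_smul, h1, h2]
  module

/-- The commutator of two matrices which are triangular for an injective height function on the
indices is strictly triangular. -/
theorem lie_apply_eq_zero_of_triangular {ι : Type*} [Fintype ι] (ρ : ι → ℤ)
    (hρ : Function.Injective ρ) {X Y : Matrix ι ι ℂ} (hX : ∀ i j, ρ j < ρ i → X i j = 0)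
    (hY : ∀ i j, ρ j < ρ i → Y i j = 0) {i j : ι} (hij : ρ j ≤ ρ i) : ⁅X, Y⁆ i j = 0 := by
  classical
  rw [Ring.lie_def, Matrix.sub_apply, mul_apply, mul_apply, ← Finset.sum_sub_distrib]
  refine Finset.sum_eq_zero fun k _ => ?_
  rcases lt_trichotomy (ρ k) (ρ i) with h | h | h
  · rw [hX i k h, hY i k h]; ring
  · obtain rfl := hρ h
    rcases hij.lt_or_eq with h' | h'
    · rw [hX k j h', hY k j h']; ring
    · rw [hρ h']; ring
  · rw [hX k j (hij.trans_lt h), hY k j (hij.trans_lt h)]; ring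

/-- Index set of `2r + 1` elements, arranged into `r` pairs and one further index. -/
abbrev PairIndex (r : ℕ) : Type := Option (Fin r × Fin 2)

variable {r : ℕ}

/-- The `2 × 2` block of a matrix at a pair of pairs. -/
def pairBlock (X : Matrix (PairIndex r) (PairIndex r) ℂ) (k l : Fin r) :
    Matrix (Fin 2) (Fin 2) ℂ :=
  Matrix.of fun α β => X (some (k, α)) (some (l, β))

/-- The part of the last column at a pair. -/
def pairCol (X : Matrix (PairIndex r) (PairIndex r) ℂ) (k : Fin r) : Fin 2 → ℂ :=
  fun α => X (some (k, α)) none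

/-- The part of the last row at a pair. -/
def pairRow (X : Matrix (PairIndex r) (PairIndex r) ℂ) (l : Fin r) : Fin 2 → ℂ :=
  fun β => X none (some (l, β))

theorem pairExt {X Y : Matrix (PairIndex r) (PairIndex r) ℂ}
    (hb : ∀ k l, pairBlock X k l = pairBlock Y k l) (hc : ∀ k, pairCol X k = pairCol Y k)
    (hr : ∀ l, pairRow X l = pairRow Y l) (h : X none none = Y none none) : X = Y := by
  ext i j
  rcases i with _ | ⟨k, α⟩ <;> rcases j with _ | ⟨l, β⟩
  · exact h
  · exact congrFun (hr l) β
  · exact congrFun (hc k) α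
  · exact congrFun (congrFun (hb k l) α) β

/-- Left multiplication by `q` on `2 × 2` matrices, conjugated by the map which multiplies the
scalar part by `lam` and fixes the traceless part (for traceless `q`). -/
def diagBlockOp (q : Matrix (Fin 2) (Fin 2) ℂ) (lam : ℂ) (x : Matrix (Fin 2) (Fin 2) ℂ) :
    Matrix (Fin 2) (Fin 2) ℂ :=
  q * x + ((lam - 1) / 2 * x.trace) • q + ((lam⁻¹ - 1) / 2 * (q * x).trace) • 1

theorem trace_diagBlockOp {q : Matrix (Fin 2) (Fin 2) ℂ} (hq : q.trace = 0) (lam : ℂ)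
    (x : Matrix (Fin 2) (Fin 2) ℂ) : (diagBlockOp q lam x).trace = lam⁻¹ * (q * x).trace := by
  simp only [diagBlockOp, trace_add, trace_smul, hq, trace_one, Fintype.card_fin, smul_eq_mul]
  push_cast
  ring

theorem diagBlockOp_diagBlockOp {p q : Matrix (Fin 2) (Fin 2) ℂ} (hp : p.trace = 0)
    (hq : q.trace = 0) {lam : ℂ} (hl : lam ≠ 0) (x : Matrix (Fin 2) (Fin 2) ℂ) :
    diagBlockOp p lam (diagBlockOp q lam x) = p * q * x + ((lam - 1) / 2 * x.trace) • (p * q) +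
      ((lam⁻¹ - 1) / 2 * ((p * q * x).trace + (lam - 1) / 2 * x.trace * (p * q).trace)) •
        (1 : Matrix (Fin 2) (Fin 2) ℂ) := by
  have h : p * diagBlockOp q lam x = p * q * x + ((lam - 1) / 2 * x.trace) • (p * q) +
      ((lam⁻¹ - 1) / 2 * (q * x).trace) • p := by
    simp [diagBlockOp, mul_add, mul_assoc]
  rw [diagBlockOp, trace_diagBlockOp hq, h]
  simp only [trace_add, trace_smul, hp, smul_eq_mul, mul_zero, add_zero]
  match_scalars <;> field_simp <;> ring

/-- The operator acting on the blocks above the diagonal by left multiplication by `q`, on those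
below the diagonal by right multiplication by `-q`, and on the diagonal blocks by `diagBlockOp`;
the last diagonal entry is such that the result is traceless. -/
def pairOpFun (q : Matrix (Fin 2) (Fin 2) ℂ) (lam : ℂ)
    (X : Matrix (PairIndex r) (PairIndex r) ℂ) : Matrix (PairIndex r) (PairIndex r) ℂ :=
  Matrix.of fun i j => match i, j with
    | some (k, α), some (l, β) =>
      if k < l then (q * pairBlock X k l) α β
      else if l < k then -(pairBlock X k l * q) α β
      else diagBlockOp q lam (pairBlock X k l) α β
    | some (k, α), none => (q *ᵥ pairCol X k) α
    | none, some (l, β) => -(pairRow X l ᵥ* q) β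
    | none, none => -∑ k, (diagBlockOp q lam (pairBlock X k k)).trace

theorem pairBlock_pairOpFun (q : Matrix (Fin 2) (Fin 2) ℂ) (lam : ℂ)
    (X : Matrix (PairIndex r) (PairIndex r) ℂ) (k l : Fin r) :
    pairBlock (pairOpFun q lam X) k l = if k < l then q * pairBlock X k l
      else if l < k then -(pairBlock X k l * q) else diagBlockOp q lam (pairBlock X k l) := by
  ext α β
  simp only [pairBlock, pairOpFun, of_apply]
  split_ifs <;> rfl

theorem pairCol_pairOpFun (q : Matrix (Fin 2) (Fin 2) ℂ) (lam : ℂ)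
    (X : Matrix (PairIndex r) (PairIndex r) ℂ) (k : Fin r) :
    pairCol (pairOpFun q lam X) k = q *ᵥ pairCol X k := rfl

theorem pairRow_pairOpFun (q : Matrix (Fin 2) (Fin 2) ℂ) (lam : ℂ)
    (X : Matrix (PairIndex r) (PairIndex r) ℂ) (l : Fin r) :
    pairRow (pairOpFun q lam X) l = -(pairRow X l ᵥ* q) := rfl

theorem pairOpFun_none_none (q : Matrix (Fin 2) (Fin 2) ℂ) (lam : ℂ)
    (X : Matrix (PairIndex r) (PairIndex r) ℂ) :
    pairOpFun q lam X none none = -∑ k, (diagBlockOp q lam (pairBlock X k k)).trace := rfl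

theorem trace_eq_pairBlock (X : Matrix (PairIndex r) (PairIndex r) ℂ) :
    X.trace = X none none + ∑ k, (pairBlock X k k).trace := by
  simp [Matrix.trace, Fintype.sum_option, Fintype.sum_prod_type, pairBlock]

/-- `pairOpFun` as a linear map. -/
def pairOp (q : Matrix (Fin 2) (Fin 2) ℂ) (lam : ℂ) :
    Matrix (PairIndex r) (PairIndex r) ℂ →ₗ[ℂ] Matrix (PairIndex r) (PairIndex r) ℂ where
  toFun := pairOpFun q lam
  map_add' X Y := by
    have hd : ∀ x y, diagBlockOp q lam (x + y) = diagBlockOp q lam x + diagBlockOp q lam y := by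
      intro x y
      simp only [diagBlockOp, mul_add, trace_add]
      module
    have hb : ∀ A B : Matrix (PairIndex r) (PairIndex r) ℂ, ∀ k l,
      pairBlock (A + B) k l = pairBlock A k l + pairBlock B k l := fun _ _ _ _ => rfl
    have hc : ∀ A B : Matrix (PairIndex r) (PairIndex r) ℂ, ∀ k,
      pairCol (A + B) k = pairCol A k + pairCol B k := fun _ _ _ => rfl
    have hr : ∀ A B : Matrix (PairIndex r) (PairIndex r) ℂ, ∀ k,
      pairRow (A + B) k = pairRow A k + pairRow B k := fun _ _ _ => rfl
    refine pairExt (fun k l => ?_) (fun k => ?_) (fun l => ?_) ?_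
    · rw [hb]
      simp only [pairBlock_pairOpFun, hb]
      split_ifs
      · rw [mul_add]
      · rw [add_mul, neg_add]
      · rw [hd]
    · rw [hc]
      simp only [pairCol_pairOpFun, hc, mulVec_add]
    · rw [hr]
      simp only [pairRow_pairOpFun, hr, add_vecMul, neg_add]
    · rw [Matrix.add_apply]
      simp only [pairOpFun_none_none, hb, hd, trace_add, Finset.sum_add_distrib, neg_add]
  map_smul' z X := by
    have hd : ∀ x, diagBlockOp q lam (z • x) = z • diagBlockOp q lam x := by
      intro x
      simp only [diagBlockOp, mul_smul_comm, trace_smul, smul_eq_mul]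
      module
    have hb : ∀ A : Matrix (PairIndex r) (PairIndex r) ℂ, ∀ k l,
      pairBlock (z • A) k l = z • pairBlock A k l := fun _ _ _ => rfl
    have hc : ∀ A : Matrix (PairIndex r) (PairIndex r) ℂ, ∀ k,
      pairCol (z • A) k = z • pairCol A k := fun _ _ => rfl
    have hr : ∀ A : Matrix (PairIndex r) (PairIndex r) ℂ, ∀ k,
      pairRow (z • A) k = z • pairRow A k := fun _ _ => rfl
    rw [RingHom.id_apply]
    refine pairExt (fun k l => ?_) (fun k => ?_) (fun l => ?_) ?_
    · rw [hb]
      simp only [pairBlock_pairOpFun, hb]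
      split_ifs
      · rw [mul_smul_comm]
      · rw [smul_mul_assoc, smul_neg]
      · rw [hd]
    · rw [hc]
      simp only [pairCol_pairOpFun, hc, mulVec_smul]
    · rw [hr]
      simp only [pairRow_pairOpFun, hr, smul_vecMul, smul_neg]
    · rw [Matrix.smul_apply]
      simp only [pairOpFun_none_none, hb, hd, trace_smul, smul_neg, Finset.smul_sum]

theorem pairOp_apply (q : Matrix (Fin 2) (Fin 2) ℂ) (lam : ℂ)
    (X : Matrix (PairIndex r) (PairIndex r) ℂ) : pairOp q lam X = pairOpFun q lam X := rfl

theorem trace_pairOp (q : Matrix (Fin 2) (Fin 2) ℂ) (lam : ℂ)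
    (X : Matrix (PairIndex r) (PairIndex r) ℂ) : (pairOp q lam X).trace = 0 := by
  rw [pairOp_apply, trace_eq_pairBlock, pairOpFun_none_none, neg_add_eq_zero]
  refine Finset.sum_congr rfl fun k _ => ?_
  simp [pairBlock_pairOpFun]

theorem pairOp_sq {q : Matrix (Fin 2) (Fin 2) ℂ} {ε : ℂ} (hq : q * q = ε • 1)
    (ht : q.trace = 0) {lam : ℂ} (hl : lam ≠ 0) {X : Matrix (PairIndex r) (PairIndex r) ℂ}
    (hX : X.trace = 0) : pairOp q lam (pairOp q lam X) = ε • X := by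
  have hd : ∀ x, diagBlockOp q lam (diagBlockOp q lam x) = ε • x := by
    intro x
    rw [diagBlockOp_diagBlockOp ht ht hl, hq]
    simp only [smul_mul_assoc, one_mul, trace_smul, trace_one, Fintype.card_fin, smul_eq_mul]
    push_cast
    match_scalars
    · ring
    · field_simp
      ring
  refine pairExt (fun k l => ?_) (fun k => ?_) (fun l => ?_) ?_
  · have : pairBlock (ε • X) k l = ε • pairBlock X k l := rfl
    rw [this]
    simp only [pairOp_apply, pairBlock_pairOpFun]
    split_ifs
    · rw [← mul_assoc, hq, smul_mul_assoc, one_mul]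
    · rw [neg_mul, neg_neg, mul_assoc, hq, mul_smul_comm, mul_one]
    · exact hd _
  · have : pairCol (ε • X) k = ε • pairCol X k := rfl
    rw [this]
    simp only [pairOp_apply, pairCol_pairOpFun, mulVec_mulVec, hq, smul_mulVec, one_mulVec]
  · have : pairRow (ε • X) l = ε • pairRow X l := rfl
    rw [this]
    simp only [pairOp_apply, pairRow_pairOpFun, neg_vecMul, neg_neg, vecMul_vecMul, hq,
      vecMul_smul, vecMul_one]
  · rw [pairOp_apply, pairOpFun_none_none]
    have h : ∀ k, pairBlock (pairOp q lam X) k k = diagBlockOp q lam (pairBlock X k k) := by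
      intro k
      simp [pairOp_apply, pairBlock_pairOpFun]
    rw [trace_eq_pairBlock] at hX
    rw [Matrix.smul_apply, smul_eq_mul]
    simp only [h, hd, trace_smul, smul_eq_mul, ← Finset.mul_sum]
    linear_combination ε * -hX

theorem pairOp_anticomm {p q : Matrix (Fin 2) (Fin 2) ℂ} (hpq : p * q = -(q * p))
    (hp : p.trace = 0) (hq : q.trace = 0) {lam : ℂ} (hl : lam ≠ 0)
    (X : Matrix (PairIndex r) (PairIndex r) ℂ) :
    pairOp p lam (pairOp q lam X) = -pairOp q lam (pairOp p lam X) := by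
  have hd : ∀ x, diagBlockOp p lam (diagBlockOp q lam x) =
      -diagBlockOp q lam (diagBlockOp p lam x) := by
    intro x
    rw [diagBlockOp_diagBlockOp hp hq hl, diagBlockOp_diagBlockOp hq hp hl, hpq]
    simp only [neg_mul, trace_neg]
    module
  refine pairExt (fun k l => ?_) (fun k => ?_) (fun l => ?_) ?_
  · have : ∀ A : Matrix (PairIndex r) (PairIndex r) ℂ,
      pairBlock (-A) k l = -pairBlock A k l := fun _ => rfl
    rw [this]
    simp only [pairOp_apply, pairBlock_pairOpFun]
    split_ifs
    · rw [← mul_assoc, ← mul_assoc, hpq, neg_mul]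
    · rw [neg_mul, neg_neg, neg_mul, neg_neg, mul_assoc, mul_assoc, hpq, mul_neg, neg_neg]
    · exact hd _
  · have : ∀ A : Matrix (PairIndex r) (PairIndex r) ℂ,
      pairCol (-A) k = -pairCol A k := fun _ => rfl
    rw [this]
    simp only [pairOp_apply, pairCol_pairOpFun, mulVec_mulVec, hpq, neg_mulVec]
  · have : ∀ A : Matrix (PairIndex r) (PairIndex r) ℂ,
      pairRow (-A) l = -pairRow A l := fun _ => rfl
    rw [this]
    simp only [pairOp_apply, pairRow_pairOpFun, neg_vecMul, neg_neg, vecMul_vecMul, hpq,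
      vecMul_neg]
  · rw [Matrix.neg_apply]
    have h : ∀ (s : Matrix (Fin 2) (Fin 2) ℂ) k,
        pairBlock (pairOp s lam X) k k = diagBlockOp s lam (pairBlock X k k) := by
      intro s k
      simp [pairOp_apply, pairBlock_pairOpFun]
    have h' : ∀ (s : Matrix (Fin 2) (Fin 2) ℂ) (Y : Matrix (PairIndex r) (PairIndex r) ℂ),
        pairOp s lam Y none none = -∑ k, (diagBlockOp s lam (pairBlock Y k k)).trace :=
      fun _ _ => rfl
    rw [h', h']
    simp only [h, hd, trace_neg, Finset.sum_neg_distrib]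

/-- The height function on indices for which `pairOp (diag(μ, -μ))` has triangular eigenvectors. -/
def pairHeight : PairIndex r → ℤ
  | none => 0
  | some (k, α) => if α = 0 then (k : ℤ) - r else r - k

theorem pairHeight_injective : Function.Injective (pairHeight (r := r)) := by
  rintro (_ | ⟨k, α⟩) (_ | ⟨l, β⟩) h
  · rfl
  · have := l.2
    simp only [pairHeight] at h
    split_ifs at h <;> omega
  · have := k.2
    simp only [pairHeight] at h
    split_ifs at h <;> omega
  · have := k.2
    have := l.2
    simp only [pairHeight] at h
    have h1 : k = l ∧ α = β := by
      simp only [Fin.ext_iff]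
      split_ifs at h with h1 h2 h2 <;> omega
    rw [h1.1, h1.2]

theorem pairOp_diagonal_apply (μ lam : ℂ) (X : Matrix (PairIndex r) (PairIndex r) ℂ)
    {i j : PairIndex r} (hij : i ≠ j) :
    pairOp (diagonal ![μ, -μ]) lam X i j =
      (if pairHeight i < pairHeight j then μ else -μ) * X i j := by
  rcases i with _ | ⟨k, α⟩ <;> rcases j with _ | ⟨l, β⟩
  · exact absurd rfl hij
  · have := l.2
    change -(pairRow X l ᵥ* diagonal ![μ, -μ]) β = _
    rw [vecMul_diagonal]
    fin_cases β
    · simp [pairHeight, pairRow, mul_comm]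
    · simp [pairHeight, pairRow, mul_comm]
  · have := k.2
    change (diagonal ![μ, -μ] *ᵥ pairCol X k) α = _
    rw [mulVec_diagonal]
    fin_cases α
    · simp [pairHeight, pairCol]
    · simp [pairHeight, pairCol, this.le]
  · have := k.2
    have := l.2
    change pairBlock (pairOpFun (diagonal ![μ, -μ]) lam X) k l α β = _
    rw [pairBlock_pairOpFun]
    rcases lt_trichotomy k l with h | rfl | h
    · have h' : (k : ℕ) < l := h
      rw [if_pos h, diagonal_mul]
      fin_cases α <;> fin_cases β <;> simp [pairHeight, pairBlock] <;> omega
    · rw [if_neg (lt_irrefl _), if_neg (lt_irrefl _)]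
      fin_cases α <;> fin_cases β <;>
        simp [pairHeight, pairBlock, diagBlockOp] at hij ⊢ <;> omega
    · have h' : (l : ℕ) < k := h
      rw [if_neg h.asymm, if_pos h, Matrix.neg_apply, mul_diagonal]
      fin_cases α <;> fin_cases β <;> simp [pairHeight, pairBlock, mul_comm] <;> omega

theorem pairOp_diagonal_apply_self (μ lam : ℂ) {X : Matrix (PairIndex r) (PairIndex r) ℂ}
    (hX : ∀ i, X i i = 0) (i : PairIndex r) : pairOp (diagonal ![μ, -μ]) lam X i i = 0 := by
  have h : ∀ k α, diagBlockOp (diagonal ![μ, -μ]) lam (pairBlock X k k) α α = 0 := by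
    intro k α
    have h0 : ∀ α, pairBlock X k k α α = 0 := fun α => hX (some (k, α))
    simp [diagBlockOp, Matrix.trace, diagonal_mul, h0]
  rcases i with _ | ⟨k, α⟩
  · rw [pairOp_apply, pairOpFun_none_none]
    simp [Matrix.trace, h]
  · change pairBlock (pairOpFun (diagonal ![μ, -μ]) lam X) k k α α = _
    rw [pairBlock_pairOpFun, if_neg (lt_irrefl _), if_neg (lt_irrefl _), h]

theorem pairOp_diagonal_lie_pos {μ : ℂ} (hμ : μ ≠ 0) (lam : ℂ)
    {X Y : Matrix (PairIndex r) (PairIndex r) ℂ} (hX : pairOp (diagonal ![μ, -μ]) lam X = μ • X)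
    (hY : pairOp (diagonal ![μ, -μ]) lam Y = μ • Y) :
    pairOp (diagonal ![μ, -μ]) lam ⁅X, Y⁆ = μ • ⁅X, Y⁆ := by
  have tri : ∀ Z : Matrix (PairIndex r) (PairIndex r) ℂ,
      pairOp (diagonal ![μ, -μ]) lam Z = μ • Z → ∀ i j, pairHeight j < pairHeight i →
        Z i j = 0 := by
    intro Z hZ i j hij
    have h := congrFun (congrFun hZ i) j
    rw [pairOp_diagonal_apply _ _ _ (by rintro rfl; exact lt_irrefl _ hij), if_neg hij.asymm,
      Matrix.smul_apply, smul_eq_mul] at h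
    have : μ * Z i j = 0 := by linear_combination -(1 / 2 : ℂ) * h
    exact (mul_eq_zero.1 this).resolve_left hμ
  have h0 := fun i j => lie_apply_eq_zero_of_triangular (i := i) (j := j) _ pairHeight_injective
    (tri X hX) (tri Y hY)
  ext i j
  rw [Matrix.smul_apply, smul_eq_mul]
  by_cases hij : i = j
  · subst hij
    rw [pairOp_diagonal_apply_self _ _ fun i => h0 i i le_rfl, h0 i i le_rfl, mul_zero]
  · rw [pairOp_diagonal_apply _ _ _ hij]
    split_ifs with h
    · rfl
    · rw [h0 i j (not_lt.1 h), mul_zero, mul_zero]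

theorem pairOp_diagonal_lie_neg {μ : ℂ} (hμ : μ ≠ 0) (lam : ℂ)
    {X Y : Matrix (PairIndex r) (PairIndex r) ℂ}
    (hX : pairOp (diagonal ![μ, -μ]) lam X = -μ • X)
    (hY : pairOp (diagonal ![μ, -μ]) lam Y = -μ • Y) :
    pairOp (diagonal ![μ, -μ]) lam ⁅X, Y⁆ = -μ • ⁅X, Y⁆ := by
  have tri : ∀ Z : Matrix (PairIndex r) (PairIndex r) ℂ,
      pairOp (diagonal ![μ, -μ]) lam Z = -μ • Z → ∀ i j, -pairHeight j < -pairHeight i →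
        Z i j = 0 := by
    intro Z hZ i j hij
    have h := congrFun (congrFun hZ i) j
    rw [pairOp_diagonal_apply _ _ _ (by rintro rfl; exact lt_irrefl _ hij), if_pos (by omega),
      Matrix.smul_apply, smul_eq_mul] at h
    have : μ * Z i j = 0 := by linear_combination (1 / 2 : ℂ) * h
    exact (mul_eq_zero.1 this).resolve_left hμ
  have h0 := fun i j => lie_apply_eq_zero_of_triangular (i := i) (j := j)
    (fun i => -pairHeight i) (neg_injective.comp pairHeight_injective) (tri X hX) (tri Y hY)
  ext i j
  rw [Matrix.smul_apply, smul_eq_mul]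
  by_cases hij : i = j
  · subst hij
    rw [pairOp_diagonal_apply_self _ _ fun i => h0 i i le_rfl, h0 i i le_rfl, mul_zero]
  · rw [pairOp_diagonal_apply _ _ _ hij]
    split_ifs with h
    · rw [h0 i j (by omega), mul_zero, mul_zero]
    · rfl

/-- The matrix with all `2 × 2` diagonal blocks equal to `s` and last diagonal entry `1`. -/
def pairDiag (s : Matrix (Fin 2) (Fin 2) ℂ) : Matrix (PairIndex r) (PairIndex r) ℂ :=
  Matrix.of fun i j => match i, j with
    | some (k, α), some (l, β) => if k = l then s α β else 0
    | none, none => 1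
    | _, _ => 0

theorem pairDiag_one : (pairDiag 1 : Matrix (PairIndex r) (PairIndex r) ℂ) = 1 := by
  ext i j
  rcases i with _ | ⟨k, α⟩ <;> rcases j with _ | ⟨l, β⟩ <;>
    simp [pairDiag, one_apply, ite_and]

theorem pairBlock_pairDiag_mul (s : Matrix (Fin 2) (Fin 2) ℂ)
    (X : Matrix (PairIndex r) (PairIndex r) ℂ) (k l : Fin r) :
    pairBlock (pairDiag s * X) k l = s * pairBlock X k l := by
  ext α β
  simp [pairBlock, mul_apply, pairDiag, Fintype.sum_option, Fintype.sum_prod_type]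

theorem pairCol_pairDiag_mul (s : Matrix (Fin 2) (Fin 2) ℂ)
    (X : Matrix (PairIndex r) (PairIndex r) ℂ) (k : Fin r) :
    pairCol (pairDiag s * X) k = s *ᵥ pairCol X k := by
  ext α
  simp [pairCol, mul_apply, mulVec, dotProduct, pairDiag, Fintype.sum_option,
    Fintype.sum_prod_type]

theorem pairRow_pairDiag_mul (s : Matrix (Fin 2) (Fin 2) ℂ)
    (X : Matrix (PairIndex r) (PairIndex r) ℂ) (l : Fin r) :
    pairRow (pairDiag s * X) l = pairRow X l := by
  ext α
  simp [pairRow, mul_apply, pairDiag, Fintype.sum_option]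

theorem pairDiag_mul_none_none (s : Matrix (Fin 2) (Fin 2) ℂ)
    (X : Matrix (PairIndex r) (PairIndex r) ℂ) :
    (pairDiag s * X : Matrix (PairIndex r) (PairIndex r) ℂ) none none =
      X none none := by
  simp [mul_apply, pairDiag, Fintype.sum_option]

theorem pairBlock_mul_pairDiag (s : Matrix (Fin 2) (Fin 2) ℂ)
    (X : Matrix (PairIndex r) (PairIndex r) ℂ) (k l : Fin r) :
    pairBlock (X * pairDiag s) k l = pairBlock X k l * s := by
  ext α β
  simp [pairBlock, mul_apply, pairDiag, Fintype.sum_option, Fintype.sum_prod_type]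

theorem pairCol_mul_pairDiag (s : Matrix (Fin 2) (Fin 2) ℂ)
    (X : Matrix (PairIndex r) (PairIndex r) ℂ) (k : Fin r) :
    pairCol (X * pairDiag s) k = pairCol X k := by
  ext α
  simp [pairCol, mul_apply, pairDiag, Fintype.sum_option]

theorem pairRow_mul_pairDiag (s : Matrix (Fin 2) (Fin 2) ℂ)
    (X : Matrix (PairIndex r) (PairIndex r) ℂ) (l : Fin r) :
    pairRow (X * pairDiag s) l = pairRow X l ᵥ* s := by
  ext α
  simp [pairRow, mul_apply, vecMul, dotProduct, pairDiag, Fintype.sum_option,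
    Fintype.sum_prod_type]

theorem mul_pairDiag_none_none (s : Matrix (Fin 2) (Fin 2) ℂ)
    (X : Matrix (PairIndex r) (PairIndex r) ℂ) :
    (X * pairDiag s : Matrix (PairIndex r) (PairIndex r) ℂ) none none =
      X none none := by
  simp [mul_apply, pairDiag, Fintype.sum_option]

theorem pairDiag_mul_pairDiag (s t : Matrix (Fin 2) (Fin 2) ℂ) :
    (pairDiag s * pairDiag t : Matrix (PairIndex r) (PairIndex r) ℂ) = pairDiag (s * t) := by
  refine pairExt (fun k l => ?_) (fun k => ?_) (fun l => ?_) ?_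
  · rw [pairBlock_pairDiag_mul]
    ext α β
    by_cases h : k = l <;> simp [pairBlock, pairDiag, mul_apply, h]
  · rw [pairCol_pairDiag_mul]
    have : ∀ s, pairCol (pairDiag s) k = 0 := fun _ => rfl
    rw [this, this, mulVec_zero]
  · rw [pairRow_pairDiag_mul]
    rfl
  · rw [pairDiag_mul_none_none]
    rfl

theorem pairOp_conj {q d s t : Matrix (Fin 2) (Fin 2) ℂ} (hst : s * t = 1) (hts : t * s = 1)
    (hq : q * s = s * d) (lam : ℂ) (X : Matrix (PairIndex r) (PairIndex r) ℂ) :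
    pairOp q lam (pairDiag s * X * pairDiag t) =
      pairDiag s * pairOp d lam X * pairDiag t := by
  have hq' : t * q = d * t := by
    calc t * q = t * (q * s) * t := by rw [mul_assoc, mul_assoc, hst, mul_one]
      _ = d * t := by rw [hq, ← mul_assoc, hts, one_mul]
  have hd : ∀ x, diagBlockOp q lam (s * x * t) = s * diagBlockOp d lam x * t := by
    intro x
    have h1 : q * (s * x * t) = s * (d * x) * t := by
      rw [← mul_assoc, ← mul_assoc, hq, mul_assoc s d x]
    have h2 : ∀ y, (s * y * t).trace = y.trace := by
      intro y
      rw [trace_mul_comm, ← mul_assoc, hts, one_mul]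
    have h3 : q = s * d * t := by rw [← hq, mul_assoc, hst, mul_one]
    rw [diagBlockOp, h1, h2, h2, diagBlockOp, mul_add, mul_add, add_mul, add_mul, mul_smul_comm,
      mul_smul_comm, smul_mul_assoc, smul_mul_assoc, mul_one, hst, ← h3]
  have htr : ∀ x, (diagBlockOp q lam (s * x * t)).trace = (diagBlockOp d lam x).trace := by
    intro x
    rw [hd, trace_mul_comm, ← mul_assoc, hts, one_mul]
  refine pairExt (fun k l => ?_) (fun k => ?_) (fun l => ?_) ?_
  · rw [pairOp_apply, pairBlock_pairOpFun, pairBlock_mul_pairDiag, pairBlock_pairDiag_mul,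
      pairBlock_mul_pairDiag, pairBlock_pairDiag_mul, pairOp_apply, pairBlock_pairOpFun]
    split_ifs
    · rw [← mul_assoc, ← mul_assoc, hq, mul_assoc s d]
    · rw [mul_assoc _ t q, hq', mul_neg, neg_mul]
      simp only [mul_assoc]
    · exact hd _
  · rw [pairOp_apply, pairCol_pairOpFun, pairCol_mul_pairDiag, pairCol_pairDiag_mul,
      pairCol_mul_pairDiag, pairCol_pairDiag_mul, pairOp_apply, pairCol_pairOpFun, mulVec_mulVec,
      mulVec_mulVec, hq]
  · rw [pairOp_apply, pairRow_pairOpFun, pairRow_mul_pairDiag, pairRow_pairDiag_mul,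
      pairRow_mul_pairDiag, pairRow_pairDiag_mul, pairOp_apply, pairRow_pairOpFun, vecMul_vecMul,
      neg_vecMul, vecMul_vecMul, hq']
  · rw [pairOp_apply, pairOpFun_none_none, mul_pairDiag_none_none, pairDiag_mul_none_none,
      pairOp_apply, pairOpFun_none_none]
    simp only [pairBlock_mul_pairDiag, pairBlock_pairDiag_mul, htr]

theorem pairOp_lie_of_conj {q d s t : Matrix (Fin 2) (Fin 2) ℂ} (hst : s * t = 1)
    (hts : t * s = 1) (hq : q * s = s * d) (lam ν : ℂ)
    (h : ∀ X Y : Matrix (PairIndex r) (PairIndex r) ℂ, pairOp d lam X = ν • X →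
      pairOp d lam Y = ν • Y → pairOp d lam ⁅X, Y⁆ = ν • ⁅X, Y⁆)
    {X Y : Matrix (PairIndex r) (PairIndex r) ℂ} (hX : pairOp q lam X = ν • X)
    (hY : pairOp q lam Y = ν • Y) : pairOp q lam ⁅X, Y⁆ = ν • ⁅X, Y⁆ := by
  have hST : pairDiag s * pairDiag t = (1 : Matrix (PairIndex r) (PairIndex r) ℂ) := by
    rw [pairDiag_mul_pairDiag, hst, pairDiag_one]
  have hTS : pairDiag t * pairDiag s = (1 : Matrix (PairIndex r) (PairIndex r) ℂ) := by
    rw [pairDiag_mul_pairDiag, hts, pairDiag_one]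
  have hback : ∀ Z : Matrix (PairIndex r) (PairIndex r) ℂ,
      pairDiag s * (pairDiag t * Z * pairDiag s) * pairDiag t = Z := by
    intro Z
    calc _ = (pairDiag s * pairDiag t) * Z * (pairDiag s * pairDiag t) := by
          simp only [mul_assoc]
      _ = Z := by rw [hST, one_mul, mul_one]
  have hconj : ∀ Z : Matrix (PairIndex r) (PairIndex r) ℂ, pairOp q lam Z = ν • Z →
      pairOp d lam (pairDiag t * Z * pairDiag s) = ν • (pairDiag t * Z * pairDiag s) := by
    intro Z hZ
    have h1 := pairOp_conj hst hts hq lam (pairDiag t * Z * pairDiag s)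
    rw [hback, hZ] at h1
    calc pairOp d lam (pairDiag t * Z * pairDiag s)
        = (pairDiag t * pairDiag s) * pairOp d lam (pairDiag t * Z * pairDiag s) *
            (pairDiag t * pairDiag s) := by rw [hTS, one_mul, mul_one]
      _ = pairDiag t * (pairDiag s * pairOp d lam (pairDiag t * Z * pairDiag s) * pairDiag t) *
            pairDiag s := by simp only [mul_assoc]
      _ = ν • (pairDiag t * Z * pairDiag s) := by
          rw [← h1, mul_smul_comm, smul_mul_assoc]
  have hlie : pairDiag s * ⁅pairDiag t * X * pairDiag s, pairDiag t * Y * pairDiag s⁆ *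
      pairDiag t = ⁅X, Y⁆ := by
    have h2 : ∀ A B : Matrix (PairIndex r) (PairIndex r) ℂ,
        (pairDiag t * A * pairDiag s) * (pairDiag t * B * pairDiag s) =
          pairDiag t * (A * B) * pairDiag s := by
      intro A B
      calc _ = pairDiag t * A * (pairDiag s * pairDiag t) * B * pairDiag s := by
            simp only [mul_assoc]
        _ = _ := by rw [hST, mul_one]; simp only [mul_assoc]
    rw [Ring.lie_def, Ring.lie_def, h2, h2, mul_sub, sub_mul, hback, hback]
  rw [← hlie, pairOp_conj hst hts hq, h _ _ (hconj X hX) (hconj Y hY), mul_smul_comm,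
    smul_mul_assoc]

/-- `pairOp q lam` is integrable on traceless matrices if `q` is diagonalizable with eigenvalues
`μ` and `-μ`. -/
theorem pairOp_integrable {q s t : Matrix (Fin 2) (Fin 2) ℂ} (hst : s * t = 1)
    (hts : t * s = 1) {μ : ℂ} (hμ : μ ≠ 0) (hq : q * s = s * diagonal ![μ, -μ]) {lam : ℂ}
    (hl : lam ≠ 0) {X Y : Matrix (PairIndex r) (PairIndex r) ℂ} (hX : X.trace = 0)
    (hY : Y.trace = 0) :
    ⁅pairOp q lam X, pairOp q lam Y⁆ + (μ * μ) • ⁅X, Y⁆ - pairOp q lam ⁅pairOp q lam X, Y⁆ -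
      pairOp q lam ⁅X, pairOp q lam Y⁆ = 0 := by
  have hq2 : q = s * diagonal ![μ, -μ] * t := by rw [← hq, mul_assoc, hst, mul_one]
  have hsq : q * q = (μ * μ) • 1 := by
    have hd : diagonal ![μ, -μ] * diagonal ![μ, -μ] =
        (μ * μ) • (1 : Matrix (Fin 2) (Fin 2) ℂ) := by
      rw [diagonal_mul_diagonal, smul_one_eq_diagonal]
      congr 1
      ext i
      fin_cases i <;> simp
    calc q * q = s * diagonal ![μ, -μ] * (t * q) := by rw [← mul_assoc, ← hq2]
      _ = s * (diagonal ![μ, -μ] * diagonal ![μ, -μ]) * t := by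
        rw [hq2, ← mul_assoc t, ← mul_assoc t, hts, one_mul]; simp only [mul_assoc]
      _ = (μ * μ) • 1 := by rw [hd, mul_smul_comm, smul_mul_assoc, mul_one, hst]
  have htr : q.trace = 0 := by
    rw [hq2, trace_mul_comm, ← mul_assoc, hts, one_mul]
    simp [Matrix.trace]
  refine nijenhuis_eq_zero_of_eigenspaces (pairOp q lam)
    (LinearMap.ker (traceLinearMap (PairIndex r) ℂ ℂ)) hμ
    (fun X hX => pairOp_sq hsq htr hl hX) ?_ ?_ hX hY
  · exact fun X Y => pairOp_lie_of_conj hst hts hq lam μ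
      fun _ _ => pairOp_diagonal_lie_pos hμ lam
  · exact fun X Y => pairOp_lie_of_conj hst hts hq lam (-μ)
      fun _ _ => pairOp_diagonal_lie_neg hμ lam

end PairOp

section RealForms

open Matrix

variable {r : ℕ}

/-- A pair of complex linear operators on matrices whose restrictions to the traceless matrices
form a complex product structure on the complex Lie algebra `sl`. -/
structure IsSLComplexProduct {ι : Type*} [Fintype ι] [DecidableEq ι]
    (P J : Matrix ι ι ℂ →ₗ[ℂ] Matrix ι ι ℂ) : Prop where
  trace_product : ∀ X, (P X).trace = 0
  trace_complex : ∀ X, (J X).trace = 0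
  product_sq : ∀ X, X.trace = 0 → P (P X) = X
  complex_sq : ∀ X, X.trace = 0 → J (J X) = -X
  anticomm : ∀ X, P (J X) = -J (P X)
  product_integrable : ∀ X Y, X.trace = 0 → Y.trace = 0 →
    ⁅P X, P Y⁆ + ⁅X, Y⁆ - P ⁅P X, Y⁆ - P ⁅X, P Y⁆ = 0
  complex_integrable : ∀ X Y, X.trace = 0 → Y.trace = 0 →
    ⁅J X, J Y⁆ - ⁅X, Y⁆ - J ⁅J X, Y⁆ - J ⁅X, J Y⁆ = 0

theorem isSLComplexProduct_pairOp {p j s t s' t' : Matrix (Fin 2) (Fin 2) ℂ} (hst : s * t = 1)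
    (hts : t * s = 1) (hp : p * s = s * diagonal ![1, -1]) (hst' : s' * t' = 1)
    (hts' : t' * s' = 1) (hj : j * s' = s' * diagonal ![Complex.I, -Complex.I])
    (hp2 : p * p = 1) (hj2 : j * j = -1) (hp0 : p.trace = 0) (hj0 : j.trace = 0)
    (hpj : p * j = -(j * p)) {lam : ℂ} (hl : lam ≠ 0) :
    IsSLComplexProduct (pairOp (r := r) p lam) (pairOp (r := r) j lam) where
  trace_product := trace_pairOp p lam
  trace_complex := trace_pairOp j lam
  product_sq X hX := by
    rw [pairOp_sq (ε := 1) (by rw [hp2, one_smul]) hp0 hl hX, one_smul]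
  complex_sq X hX := by
    rw [pairOp_sq (ε := -1) (by rw [hj2, neg_one_smul]) hj0 hl hX, neg_one_smul]
  anticomm := pairOp_anticomm hpj hp0 hj0 hl
  product_integrable X Y hX hY := by
    have := pairOp_integrable hst hts one_ne_zero hp hl hX hY
    rwa [one_mul, one_smul] at this
  complex_integrable X Y hX hY := by
    have := pairOp_integrable hst' hts' Complex.I_ne_zero hj hl hX hY
    rwa [Complex.I_mul_I, neg_one_smul, ← sub_eq_add_neg] at this

/-- Transport of an operator on matrices along a bijection of the indices. -/
def reindexOp {ι κ : Type*} [Fintype ι] [DecidableEq ι] [Fintype κ] [DecidableEq κ] (e : κ ≃ ι)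
    (K : Matrix ι ι ℂ →ₗ[ℂ] Matrix ι ι ℂ) : Matrix κ κ ℂ →ₗ[ℂ] Matrix κ κ ℂ :=
  (reindexAlgEquiv ℂ ℂ e.symm).toLinearMap ∘ₗ K ∘ₗ (reindexAlgEquiv ℂ ℂ e).toLinearMap

theorem reindexOp_apply {ι κ : Type*} [Fintype ι] [DecidableEq ι] [Fintype κ] [DecidableEq κ]
    (e : κ ≃ ι) (K : Matrix ι ι ℂ →ₗ[ℂ] Matrix ι ι ℂ) (X : Matrix κ κ ℂ) :
    reindexOp e K X = (K (X.submatrix e.symm e.symm)).submatrix e e := rfl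

theorem IsSLComplexProduct.reindex {ι κ : Type*} [Fintype ι] [DecidableEq ι] [Fintype κ]
    [DecidableEq κ] (e : κ ≃ ι) {P J : Matrix ι ι ℂ →ₗ[ℂ] Matrix ι ι ℂ}
    (h : IsSLComplexProduct P J) : IsSLComplexProduct (reindexOp e P) (reindexOp e J) := by
  have ht : ∀ X : Matrix ι ι ℂ, (X.submatrix e e).trace = X.trace := fun X =>
    Equiv.sum_comp e fun i => X i i
  have ht' : ∀ X : Matrix κ κ ℂ, (X.submatrix e.symm e.symm).trace = X.trace := fun X =>
    Equiv.sum_comp e.symm fun i => X i i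
  have hs : ∀ X : Matrix ι ι ℂ, (X.submatrix e e).submatrix e.symm e.symm = X := by
    intro X; ext; simp
  have hs' : ∀ X : Matrix κ κ ℂ, (X.submatrix e.symm e.symm).submatrix e e = X := by
    intro X; ext; simp
  have hl : ∀ X Y : Matrix ι ι ℂ, ⁅X.submatrix e e, Y.submatrix e e⁆ = ⁅X, Y⁆.submatrix e e := by
    intro X Y
    rw [Ring.lie_def, Ring.lie_def, submatrix_mul_equiv, submatrix_mul_equiv]
    rfl
  have hl' : ∀ X Y : Matrix κ κ ℂ, ⁅X, Y⁆.submatrix e.symm e.symm =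
      ⁅X.submatrix e.symm e.symm, Y.submatrix e.symm e.symm⁆ := by
    intro X Y
    rw [Ring.lie_def, Ring.lie_def, submatrix_mul_equiv, submatrix_mul_equiv]
    rfl
  have key : ∀ (ε : ℂ) (K : Matrix ι ι ℂ →ₗ[ℂ] Matrix ι ι ℂ) (X Y : Matrix κ κ ℂ),
      ⁅reindexOp e K X, reindexOp e K Y⁆ + ε • ⁅X, Y⁆ - reindexOp e K ⁅reindexOp e K X, Y⁆ -
        reindexOp e K ⁅X, reindexOp e K Y⁆ =
      (⁅K (X.submatrix e.symm e.symm), K (Y.submatrix e.symm e.symm)⁆ +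
        ε • ⁅X.submatrix e.symm e.symm, Y.submatrix e.symm e.symm⁆ -
        K ⁅K (X.submatrix e.symm e.symm), Y.submatrix e.symm e.symm⁆ -
        K ⁅X.submatrix e.symm e.symm, K (Y.submatrix e.symm e.symm)⁆).submatrix e e := by
    intro ε K X Y
    conv_lhs => enter [1, 1, 2, 2]; rw [← hs' ⁅X, Y⁆]
    simp only [reindexOp_apply, hl, hl', hs]
    rfl
  refine ⟨fun X => ?_, fun X => ?_, fun X hX => ?_, fun X hX => ?_, fun X => ?_,
    fun X Y hX hY => ?_, fun X Y hX hY => ?_⟩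
  · rw [reindexOp_apply, ht, h.trace_product]
  · rw [reindexOp_apply, ht, h.trace_complex]
  · rw [reindexOp_apply, reindexOp_apply, hs, h.product_sq _ ((ht' X).trans hX), hs']
  · rw [reindexOp_apply, reindexOp_apply, hs, h.complex_sq _ ((ht' X).trans hX)]
    exact congrArg (-·) (hs' X)
  · simp only [reindexOp_apply, hs, h.anticomm]
    rfl
  · have := key 1 P X Y
    rw [one_smul, one_smul, h.product_integrable _ _ ((ht' X).trans hX) ((ht' Y).trans hY)] at this
    exact this
  · have := key (-1) J X Y
    rw [neg_one_smul, neg_one_smul, ← sub_eq_add_neg, ← sub_eq_add_neg,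
      h.complex_integrable _ _ ((ht' X).trans hX) ((ht' Y).trans hY)] at this
    exact this

/-- `pairOp q 1` preserves real matrices if `q` is real. -/
theorem pairOp_map_conj {q : Matrix (Fin 2) (Fin 2) ℂ} (hq : q.map (starRingEnd ℂ) = q)
    {X : Matrix (PairIndex r) (PairIndex r) ℂ} (hX : X.map (starRingEnd ℂ) = X) :
    (pairOp q 1 X).map (starRingEnd ℂ) = pairOp q 1 X := by
  have hb : ∀ k l, (pairBlock X k l).map (starRingEnd ℂ) = pairBlock X k l := by
    intro k l
    ext α β
    exact congrFun (congrFun hX _) _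
  have hd : ∀ x, diagBlockOp q 1 x = q * x := by
    intro x
    simp [diagBlockOp]
  refine pairExt (fun k l => ?_) (fun k => ?_) (fun l => ?_) ?_
  · have : pairBlock ((pairOp q 1 X).map (starRingEnd ℂ)) k l =
        (pairBlock (pairOp q 1 X) k l).map (starRingEnd ℂ) := rfl
    rw [this, pairOp_apply, pairBlock_pairOpFun, hd]
    split_ifs
    · rw [Matrix.map_mul, hq, hb]
    · rw [Matrix.map_neg _ (map_neg _), Matrix.map_mul, hq, hb]
    · rw [Matrix.map_mul, hq, hb]
  · ext α
    change starRingEnd ℂ ((q *ᵥ pairCol X k) α) = (q *ᵥ pairCol X k) α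
    have h1 : starRingEnd ℂ ∘ pairCol X k = pairCol X k := funext fun β =>
      congrFun (congrFun hX _) _
    rw [RingHom.map_mulVec, hq, h1]
  · ext α
    change starRingEnd ℂ (-(pairRow X l ᵥ* q) α) = -(pairRow X l ᵥ* q) α
    have h1 : starRingEnd ℂ ∘ pairRow X l = pairRow X l := funext fun β =>
      congrFun (congrFun hX _) _
    rw [map_neg, RingHom.map_vecMul, hq, h1]
  · change starRingEnd ℂ (pairOpFun q 1 X none none) = pairOpFun q 1 X none none
    rw [pairOpFun_none_none, map_neg, map_sum]
    congr 1
    refine Finset.sum_congr rfl fun k _ => ?_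
    have h1 : (q * pairBlock X k k).map (starRingEnd ℂ) = q * pairBlock X k k := by
      rw [Matrix.map_mul, hq, hb]
    rw [hd]
    conv_rhs => rw [← h1]
    simp only [trace_fin_two, map_add, map_apply]

/-- Skewness for the form `pairDiag h` in terms of blocks. -/
theorem skew_pairDiag_iff {h : Matrix (Fin 2) (Fin 2) ℂ} (hh : hᴴ = h)
    (X : Matrix (PairIndex r) (PairIndex r) ℂ) :
    Xᴴ * pairDiag h + pairDiag h * X = 0 ↔
      (∀ k l, (pairBlock X l k)ᴴ * h + h * pairBlock X k l = 0) ∧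
      (∀ k, star (pairRow X k) + h *ᵥ pairCol X k = 0) ∧
      star (X none none) + X none none = 0 := by
  have eb : ∀ k l, pairBlock (Xᴴ * pairDiag h + pairDiag h * X) k l =
      (pairBlock X l k)ᴴ * h + h * pairBlock X k l := by
    intro k l
    rw [← pairBlock_pairDiag_mul]
    have : (pairBlock X l k)ᴴ = pairBlock Xᴴ k l := rfl
    rw [this, ← pairBlock_mul_pairDiag]
    rfl
  have ec : ∀ k, pairCol (Xᴴ * pairDiag h + pairDiag h * X) k =
      star (pairRow X k) + h *ᵥ pairCol X k := by
    intro k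
    rw [← pairCol_pairDiag_mul]
    have : star (pairRow X k) = pairCol Xᴴ k := rfl
    rw [this, ← pairCol_mul_pairDiag h Xᴴ]
    rfl
  have er : ∀ k, pairRow (Xᴴ * pairDiag h + pairDiag h * X) k =
      star (star (pairRow X k) + h *ᵥ pairCol X k) := by
    intro k
    rw [star_add, star_star, star_mulVec, hh, ← pairRow_pairDiag_mul h X]
    have : star (pairCol X k) = pairRow Xᴴ k := rfl
    rw [this, ← pairRow_mul_pairDiag h Xᴴ, add_comm]
    rfl
  have e0 : (Xᴴ * pairDiag h + pairDiag h * X : Matrix (PairIndex r) (PairIndex r) ℂ) none none =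
      star (X none none) + X none none := by
    rw [Matrix.add_apply, mul_pairDiag_none_none, pairDiag_mul_none_none]
    rfl
  constructor
  · intro H
    refine ⟨fun k l => ?_, fun k => ?_, ?_⟩
    · rw [← eb, H]; rfl
    · rw [← ec, H]; rfl
    · rw [← e0, H]; rfl
  · rintro ⟨h1, h2, h3⟩
    refine pairExt (fun k l => ?_) (fun k => ?_) (fun l => ?_) ?_
    · rw [eb, h1]; rfl
    · rw [ec, h2]; rfl
    · rw [er, h2, star_zero]; rfl
    · rw [e0, h3]; rfl

/-- The polarized Cayley–Hamilton theorem for `2 × 2` matrices, one of them traceless. -/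
theorem mul_add_mul_eq_of_trace_eq_zero {q : Matrix (Fin 2) (Fin 2) ℂ} (hq : q.trace = 0)
    (x : Matrix (Fin 2) (Fin 2) ℂ) :
    x * q + q * x = x.trace • q + (q * x).trace • (1 : Matrix (Fin 2) (Fin 2) ℂ) := by
  rw [trace_fin_two] at hq
  have h1 : q 1 1 = -q 0 0 := by linear_combination hq
  ext i j
  fin_cases i <;> fin_cases j <;>
    simp [mul_apply, trace_fin_two, h1] <;> ring

theorem diagBlockOp_skew {q h : Matrix (Fin 2) (Fin 2) ℂ} (hh : h * h = 1)
    (hq : qᴴ * h + h * q = 0) (hq0 : q.trace = 0) {x : Matrix (Fin 2) (Fin 2) ℂ}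
    (hx : xᴴ * h + h * x = 0) :
    (diagBlockOp q (-Complex.I) x)ᴴ * h + h * diagBlockOp q (-Complex.I) x = 0 := by
  have hq' := eq_neg_of_add_eq_zero_left hq
  have hx' := eq_neg_of_add_eq_zero_left hx
  have h1 : (q * x)ᴴ * h = h * (x * q) := by
    rw [conjTranspose_mul, mul_assoc, hq', mul_neg, ← mul_assoc, hx', neg_mul, neg_neg, mul_assoc]
  have h2 : star x.trace = -x.trace := by
    rw [← trace_conjTranspose, ← mul_one xᴴ, ← hh, ← mul_assoc, hx', neg_mul, trace_neg,
      trace_mul_comm, ← mul_assoc, hh, one_mul]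
  have h3 : star (q * x).trace = (q * x).trace := by
    rw [← trace_conjTranspose, ← mul_one (q * x)ᴴ, ← hh, ← mul_assoc, h1, trace_mul_comm,
      ← mul_assoc, hh, one_mul, trace_mul_comm]
  have h4 := mul_add_mul_eq_of_trace_eq_zero hq0 x
  have e1 : star ((-Complex.I - 1) / 2) = (Complex.I - 1) / 2 := by simp
  have e2 : star (((-Complex.I)⁻¹ - 1) / 2) = (-Complex.I - 1) / 2 := by simp
  have e3 : (-Complex.I)⁻¹ = Complex.I := by simp
  have h5 : h * (x * q) = x.trace • (h * q) + (q * x).trace • h - h * (q * x) := by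
    rw [eq_sub_iff_add_eq, ← mul_add, h4, mul_add, mul_smul_comm, mul_smul_comm, mul_one]
  rw [diagBlockOp, conjTranspose_add, conjTranspose_add, add_mul, add_mul, h1,
    conjTranspose_smul, conjTranspose_smul, star_mul', star_mul', e1, e2, h2, h3, e3,
    smul_mul_assoc, hq', conjTranspose_one, smul_mul_assoc, one_mul, h5, mul_add, mul_add,
    mul_smul_comm, mul_smul_comm, mul_one]
  module

/-- `pairOp q (-i)` preserves the matrices which are skew for the Hermitian form `pairDiag h` if
`q` is skew for `h`. -/
theorem pairOp_skew {q h : Matrix (Fin 2) (Fin 2) ℂ} (hh : h * h = 1) (hh' : hᴴ = h)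
    (hq : qᴴ * h + h * q = 0) (hq0 : q.trace = 0) {X : Matrix (PairIndex r) (PairIndex r) ℂ}
    (hX : Xᴴ * pairDiag h + pairDiag h * X = 0) :
    (pairOp q (-Complex.I) X)ᴴ * pairDiag h + pairDiag h * pairOp q (-Complex.I) X = 0 := by
  obtain ⟨hb, hc, -⟩ := (skew_pairDiag_iff hh' X).1 hX
  have hq' := eq_neg_of_add_eq_zero_left hq
  refine (skew_pairDiag_iff hh' _).2 ⟨fun k l => ?_, fun k => ?_, ?_⟩
  · have h1 := hb k l
    have h1' := eq_neg_of_add_eq_zero_left h1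
    rw [pairOp_apply, pairBlock_pairOpFun, pairBlock_pairOpFun]
    rcases lt_trichotomy k l with hkl | rfl | hkl
    · rw [if_neg hkl.asymm, if_pos hkl, if_pos hkl, conjTranspose_neg, conjTranspose_mul, neg_mul,
        mul_assoc, h1', mul_neg, neg_neg, ← mul_assoc, ← mul_assoc, ← add_mul, hq, zero_mul]
    · rw [if_neg (lt_irrefl _), if_neg (lt_irrefl _)]
      exact diagBlockOp_skew hh hq hq0 h1
    · rw [if_pos hkl, if_neg hkl.asymm, if_pos hkl, conjTranspose_mul, mul_assoc, hq', mul_neg,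
        mul_neg, ← mul_assoc, ← mul_assoc, ← neg_add, ← add_mul, h1, zero_mul, neg_zero]
  · have h1 := eq_neg_of_add_eq_zero_left (hc k)
    rw [pairOp_apply, pairRow_pairOpFun, pairCol_pairOpFun, star_neg, star_vecMul, h1, mulVec_neg,
      neg_neg, mulVec_mulVec, mulVec_mulVec, ← add_mulVec, hq, zero_mulVec]
  · rw [pairOp_apply, pairOpFun_none_none, star_neg, star_sum, ← neg_add, neg_eq_zero,
      ← Finset.sum_add_distrib]
    refine Finset.sum_eq_zero fun k _ => ?_
    have h1 := eq_neg_of_add_eq_zero_left (diagBlockOp_skew hh hq hq0 (hb k k))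
    rw [← trace_conjTranspose, ← mul_one (diagBlockOp _ _ _)ᴴ, ← hh, ← mul_assoc, h1, neg_mul,
      trace_neg, trace_mul_comm, ← mul_assoc, hh, one_mul, neg_add_cancel]

/-- An arrangement of `2m - 1` indices into `m - 1` pairs and one further index, such that each pair
has one index below `m`, and the further index is below `m`. -/
theorem exists_pairing {m : ℕ} (hm : 1 < m) : ∃ e : Fin (2 * m - 1) ≃ PairIndex (m - 1),
    (∀ k α, ((e.symm (some (k, α)) : Fin _) : ℕ) < m ↔ α = 0) ∧ ((e.symm none : Fin _) : ℕ) < m := by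
  let f : PairIndex (m - 1) → Fin (2 * m - 1) := fun i => match i with
    | none => ⟨m - 1, by omega⟩
    | some (k, α) => ⟨if α = 0 then k else m + k, by have := k.2; split_ifs <;> omega⟩
  have hf : Function.Injective f := by
    rintro (_ | ⟨k, α⟩) (_ | ⟨l, β⟩) h
    · rfl
    · have := l.2
      simp only [f, Fin.mk.injEq] at h
      split_ifs at h <;> omega
    · have := k.2
      simp only [f, Fin.mk.injEq] at h
      split_ifs at h <;> omega
    · have := k.2
      have := l.2
      simp only [f, Fin.mk.injEq] at h
      have h1 : k = l ∧ α = β := by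
        simp only [Fin.ext_iff]
        split_ifs at h with h1 h2 h2 <;> omega
      rw [h1.1, h1.2]
  have hbij : Function.Bijective f := by
    refine (Fintype.bijective_iff_injective_and_card f).2 ⟨hf, ?_⟩
    simp only [Fintype.card_option, Fintype.card_prod, Fintype.card_fin]
    omega
  refine ⟨(Equiv.ofBijective f hbij).symm, fun k α => ?_, ?_⟩
  · have := k.2
    simp only [Equiv.symm_symm, Equiv.ofBijective_apply, f]
    split_ifs with h <;> simp [h] <;> omega
  · simp only [Equiv.symm_symm, Equiv.ofBijective_apply, f]
    omega

theorem exists_isSLComplexProduct {m : ℕ} (hm : 1 < m)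
    (𝔤 : LieSubalgebra ℝ (Matrix (Fin (2 * m - 1)) (Fin (2 * m - 1)) ℂ))
    (h𝔤 : 𝔤 = slReal (2 * m - 1) ∨ 𝔤 = suIndefinite (2 * m - 1) m) :
    ∃ P J : Matrix (Fin (2 * m - 1)) (Fin (2 * m - 1)) ℂ →ₗ[ℂ]
        Matrix (Fin (2 * m - 1)) (Fin (2 * m - 1)) ℂ,
      IsSLComplexProduct P J ∧ (∀ X ∈ 𝔤, P X ∈ 𝔤) ∧ ∀ X ∈ 𝔤, J X ∈ 𝔤 := by
  obtain ⟨e, he, he0⟩ := exists_pairing hm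
  rcases h𝔤 with rfl | rfl
  · have hprod : IsSLComplexProduct (pairOp (r := m - 1) !![1, 0; 0, -1] 1)
        (pairOp (r := m - 1) !![0, -1; 1, 0] 1) := by
      refine isSLComplexProduct_pairOp (s := 1) (t := 1) (s' := !![1, 1; -Complex.I, Complex.I])
        (t' := !![1 / 2, Complex.I / 2; 1 / 2, -Complex.I / 2]) ?_ ?_ ?_ ?_ ?_ ?_ ?_ ?_ ?_ ?_ ?_
        one_ne_zero
      all_goals first
        | (simp [trace_fin_two]; done)
        | (ext i j; fin_cases i <;> fin_cases j <;> simp [mul_apply] <;> ring_nf <;> simp <;> norm_num)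
    have hreal : ∀ q : Matrix (Fin 2) (Fin 2) ℂ, q.map (starRingEnd ℂ) = q →
        (∀ X, (reindexOp e (pairOp q 1) X).trace = 0) →
        ∀ X ∈ slReal (2 * m - 1), reindexOp e (pairOp q 1) X ∈ slReal (2 * m - 1) := by
      rintro q hq hq0 X ⟨hX, -⟩
      refine ⟨?_, hq0 X⟩
      have h1 : (X.submatrix e.symm e.symm).map (starRingEnd ℂ) = X.submatrix e.symm e.symm := by
        ext i j
        exact congrFun (congrFun hX _) _
      have h2 := pairOp_map_conj hq h1
      ext i j
      exact congrFun (congrFun h2 _) _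
    have hprod' := hprod.reindex e
    refine ⟨_, _, hprod', hreal _ ?_ hprod'.trace_product, hreal _ ?_ hprod'.trace_complex⟩
    all_goals ext i j; fin_cases i <;> fin_cases j <;> simp
  · have hprod : IsSLComplexProduct (pairOp (r := m - 1) !![0, 1; 1, 0] (-Complex.I))
        (pairOp (r := m - 1) !![Complex.I, 0; 0, -Complex.I] (-Complex.I)) := by
      refine isSLComplexProduct_pairOp (s := !![1, 1; 1, -1])
        (t := !![1 / 2, 1 / 2; 1 / 2, -1 / 2]) (s' := 1) (t' := 1) ?_ ?_ ?_ ?_ ?_ ?_ ?_ ?_ ?_ ?_ ?_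
        (neg_ne_zero.2 Complex.I_ne_zero)
      all_goals first
        | (simp [trace_fin_two]; done)
        | (ext i j; fin_cases i <;> fin_cases j <;> simp [mul_apply] <;> ring_nf)
    have hskew : ∀ q : Matrix (Fin 2) (Fin 2) ℂ,
        qᴴ * diagonal ![1, -1] + diagonal ![1, -1] * q = 0 → q.trace = 0 →
        (∀ X, (reindexOp e (pairOp q (-Complex.I)) X).trace = 0) →
        ∀ X ∈ suIndefinite (2 * m - 1) m,
          reindexOp e (pairOp q (-Complex.I)) X ∈ suIndefinite (2 * m - 1) m := by
      rintro q hq hq1 hq0 X ⟨hX, -⟩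
      refine ⟨?_, hq0 X⟩
      have hsig : (signatureMatrix (2 * m - 1) m).submatrix e.symm e.symm =
          pairDiag (diagonal ![1, -1]) := by
        ext i j
        rcases i with _ | ⟨k, α⟩ <;> rcases j with _ | ⟨l, β⟩
        · simp [signatureMatrix, pairDiag, he0]
        · simp [signatureMatrix, pairDiag]
        · simp [signatureMatrix, pairDiag]
        · simp only [signatureMatrix, pairDiag, submatrix_apply, diagonal_apply, he, of_apply,
            EmbeddingLike.apply_eq_iff_eq, Option.some.injEq, Prod.mk.injEq, ite_and]
          fin_cases α <;> simp
      have hsig' : signatureMatrix (2 * m - 1) m =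
          (pairDiag (diagonal ![1, -1])).submatrix e e := by
        rw [← hsig]
        ext i j
        simp
      have hh : diagonal ![1, -1] * diagonal ![1, -1] = (1 : Matrix (Fin 2) (Fin 2) ℂ) := by
        ext i j; fin_cases i <;> fin_cases j <;> simp
      have hh' : (diagonal ![1, -1] : Matrix (Fin 2) (Fin 2) ℂ)ᴴ = diagonal ![1, -1] := by
        ext i j; fin_cases i <;> fin_cases j <;> simp
      have h1 : (X.submatrix e.symm e.symm)ᴴ * pairDiag (diagonal ![1, -1]) +
          pairDiag (diagonal ![1, -1]) * X.submatrix e.symm e.symm = 0 := by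
        rw [← hsig, conjTranspose_submatrix, submatrix_mul_equiv, submatrix_mul_equiv]
        exact congrArg (fun Z : Matrix _ _ ℂ => Z.submatrix e.symm e.symm) hX
      have h2 := pairOp_skew hh hh' hq hq1 h1
      rw [hsig', reindexOp_apply, conjTranspose_submatrix, submatrix_mul_equiv,
        submatrix_mul_equiv]
      exact congrArg (fun Z : Matrix _ _ ℂ => Z.submatrix e e) h2
    have hprod' := hprod.reindex e
    refine ⟨_, _, hprod', hskew _ ?_ ?_ hprod'.trace_product, hskew _ ?_ ?_ hprod'.trace_complex⟩
    · ext i j; fin_cases i <;> fin_cases j <;> simp [mul_apply]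
    · simp [trace_fin_two]
    · ext i j; fin_cases i <;> fin_cases j <;> simp [mul_apply]
    · simp [trace_fin_two]

end RealForms

section SLTangent

open Matrix

variable {n : ℕ}

theorem slFill_add (x y : SLModel n) (s t : ℂ) :
    slFill (x + y) (s + t) = slFill x s + slFill y t := by
  ext i j
  by_cases h : (i : ℕ) = 0 ∧ (j : ℕ) = 0 <;> simp [slFill, h]

theorem slFill_smul (c : ℝ) (x : SLModel n) (s : ℂ) :
    slFill (c • x) (c • s) = c • slFill x s := by
  ext i j
  by_cases h : (i : ℕ) = 0 ∧ (j : ℕ) = 0 <;> simp [slFill, h]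

theorem trace_slFill (x : SLModel (n + 1)) (t : ℂ) :
    (slFill x t).trace = t + (slFill x 0).trace := by
  rw [Matrix.trace, Matrix.trace, Fin.sum_univ_succ, Fin.sum_univ_succ]
  simp [slFill]

/-- The traceless matrix with given non-corner entries. -/
def slTraceless (n : ℕ) : SLModel n →ₗ[ℝ] Matrix (Fin n) (Fin n) ℂ where
  toFun v := slFill v (-(slFill v 0).trace)
  map_add' v w := by
    rw [← slFill_add, ← add_zero (0 : ℂ), slFill_add, trace_add, add_zero, neg_add]
  map_smul' c v := by
    have h : slFill (c • v) 0 = c • slFill v 0 := by rw [← slFill_smul, smul_zero]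
    rw [RingHom.id_apply, ← slFill_smul, h, trace_smul, smul_neg]

theorem slTraceless_apply (v : SLModel n) :
    slTraceless n v = slFill v (-(slFill v 0).trace) := rfl

theorem slCoord_slTraceless (v : SLModel n) : slCoord (slTraceless n v) = v :=
  slCoord_slFill _ _

theorem slTraceless_injective : Function.Injective (slTraceless n) := fun v w h => by
  rw [← slCoord_slTraceless v, h, slCoord_slTraceless]

theorem trace_slTraceless (v : SLModel n) : (slTraceless n v).trace = 0 := by
  cases n with
  | zero => simp
  | succ n => rw [slTraceless_apply, trace_slFill, neg_add_cancel]

theorem slTraceless_slCoord {A : Matrix (Fin n) (Fin n) ℂ} (hA : A.trace = 0) :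
    slTraceless n (slCoord A) = A := by
  cases n with
  | zero => ext i; exact i.elim0
  | succ n =>
    have h1 : slFill (slCoord A) (A 0 0) = A := by
      refine slFill_slCoord _ _ fun i j hi hj => ?_
      rw [Fin.ext (a := i) (b := 0) hi, Fin.ext (a := j) (b := 0) hj]
    have h2 := trace_slFill (slCoord A) (A 0 0)
    rw [h1, hA] at h2
    rw [slTraceless_apply, ← eq_neg_of_add_eq_zero_left h2.symm, h1]

/-- The derivative of the determinant at the identity is the trace. -/
theorem hasFDerivAt_det_one_apply {L : (Fin n → Fin n → ℂ) →L[ℝ] ℂ}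
    (hL : HasFDerivAt (fun A : Fin n → Fin n → ℂ => (Matrix.of A).det) L
      (fun i j => (1 : Matrix (Fin n) (Fin n) ℂ) i j)) (B : Fin n → Fin n → ℂ) :
    L B = (Matrix.of B).trace := by
  have hline : HasDerivAt (fun t : ℝ => fun i j : Fin n =>
      (1 : Matrix (Fin n) (Fin n) ℂ) i j + t * B i j) B 0 := by
    refine hasDerivAt_pi.2 fun i => hasDerivAt_pi.2 fun j => ?_
    have h := ((Complex.ofRealCLM.hasDerivAt (x := (0 : ℝ))).mul_const (B i j)).const_add
      ((1 : Matrix (Fin n) (Fin n) ℂ) i j)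
    simpa using h
  have h0 : (fun i j : Fin n => (1 : Matrix (Fin n) (Fin n) ℂ) i j + ((0 : ℝ) : ℂ) * B i j) =
      fun i j => (1 : Matrix (Fin n) (Fin n) ℂ) i j := by
    ext i j
    simp
  have h1 := HasFDerivAt.comp_hasDerivAt (0 : ℝ) (by rw [h0]; exact hL) hline
  have h2 : HasDerivAt (fun t : ℝ => (1 + (t : ℂ) • Matrix.of B).det) (Matrix.of B).trace 0 := by
    simp_rw +singlePass [det_one_add_smul]
    set p := (det (1 + (Polynomial.X : Polynomial ℂ) •
      (Matrix.of B).map Polynomial.C)).divX.divX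
    have h3 : HasDerivAt (fun z : ℂ => 1 + (Matrix.of B).trace * z + p.eval z * z ^ 2)
        (Matrix.of B).trace ((0 : ℝ) : ℂ) := by
      have h4 := (((hasDerivAt_id ((0 : ℝ) : ℂ)).const_mul (Matrix.of B).trace).const_add 1).add
        ((p.hasDerivAt ((0 : ℝ) : ℂ)).mul ((hasDerivAt_id ((0 : ℝ) : ℂ)).pow 2))
      convert! h4 using 1
      simp
    exact h3.comp_ofReal
  exact h1.unique h2

theorem slCofactor_slCoord_one : slCofactor (slCoord (1 : Matrix (Fin n) (Fin n) ℂ)) ≠ 0 :=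
  one_mem_slChartOne_source

theorem slFill_slCorner_one :
    slFill (slCoord (1 : Matrix (Fin n) (Fin n) ℂ))
      (slCorner (slCoord (1 : Matrix (Fin n) (Fin n) ℂ))) = 1 :=
  slFill_corner (1 : SpecialLinearGroup (Fin n) ℂ) slCofactor_slCoord_one

/-- The derivative at the identity of the parametrization of `SL(n, ℂ)`. -/
theorem exists_hasFDerivAt_slFill_slCorner (n : ℕ) :
    ∃ L : SLModel n →L[ℝ] Fin n → Fin n → ℂ, (∀ v i j, L v i j = slTraceless n v i j) ∧
      HasFDerivAt (fun x : SLModel n => fun i j => slFill x (slCorner x) i j) L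
        (slCoord (1 : Matrix (Fin n) (Fin n) ℂ)) := by
  have hmem := isOpen_slCofactor.mem_nhds (slCofactor_slCoord_one (n := n))
  have hd : ContDiffAt ℝ ∞ (fun x : SLModel n => fun i j => slFill x (slCorner x) i j)
      (slCoord (1 : Matrix (Fin n) (Fin n) ℂ)) :=
    contDiffAt_pi.2 fun i => contDiffAt_pi.2 fun j => (contDiffOn_slFill i j).contDiffAt hmem
  obtain ⟨L, hL⟩ := hd.differentiableAt (by simp)
  have hcoord : ∀ v, slCoord (Matrix.of (L v)) = v := by
    intro v
    ext p
    have h1 := hasFDerivAt_pi'.1 (hasFDerivAt_pi'.1 hL p.1.1) p.1.2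
    have h2 : HasFDerivAt (fun x : SLModel n => slFill x (slCorner x) p.1.1 p.1.2)
        (ContinuousLinearMap.proj (R := ℝ) (φ := fun _ => ℂ) p)
        (slCoord (1 : Matrix (Fin n) (Fin n) ℂ)) := by
      have h3 : (fun x : SLModel n => slFill x (slCorner x) p.1.1 p.1.2) = fun x => x p := by
        ext x
        simp [slFill, p.2]
      rw [h3]
      exact (ContinuousLinearMap.proj (R := ℝ) (φ := fun _ => ℂ) p).hasFDerivAt
    exact DFunLike.congr_fun (h1.unique h2) v
  have htrace : ∀ v, (Matrix.of (L v)).trace = 0 := by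
    intro v
    have hdet : ContDiff ℝ ∞ fun A : Fin n → Fin n → ℂ => (Matrix.of A).det :=
      contDiff_det_of_entries fun i j => contDiff_apply_apply ℝ ℂ i j
    obtain ⟨D, hD⟩ := hdet.contDiffAt.differentiableAt
      (x := fun i j => (1 : Matrix (Fin n) (Fin n) ℂ) i j) (by simp)
    rw [← hasFDerivAt_det_one_apply hD (L v)]
    have h1 : (fun i j => slFill (slCoord (1 : Matrix (Fin n) (Fin n) ℂ))
        (slCorner (slCoord (1 : Matrix (Fin n) (Fin n) ℂ))) i j) =
        fun i j => (1 : Matrix (Fin n) (Fin n) ℂ) i j := by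
      rw [slFill_slCorner_one]
    have h2 := HasFDerivAt.comp (slCoord (1 : Matrix (Fin n) (Fin n) ℂ)) (by rw [h1]; exact hD) hL
    have h3 : (fun A : Fin n → Fin n → ℂ => (Matrix.of A).det) ∘
        (fun x : SLModel n => fun i j => slFill x (slCorner x) i j) =ᶠ[nhds
          (slCoord (1 : Matrix (Fin n) (Fin n) ℂ))] fun _ => 1 := by
      filter_upwards [hmem] with x hx
      exact det_slFill_slCorner x hx
    have h4 := h2.unique ((hasFDerivAt_const (1 : ℂ) _).congr_of_eventuallyEq h3)
    exact DFunLike.congr_fun h4 v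
  refine ⟨L, fun v i j => ?_, hL⟩
  have h := slTraceless_slCoord (htrace v)
  rw [hcoord] at h
  rw [h]
  rfl

/-- The derivative at the base point of the inverse of the chart around `g`. -/
theorem exists_hasFDerivAt_slChart_symm (g : SpecialLinearGroup (Fin n) ℂ) (i j : Fin n) :
    ∃ L : SLModel n →L[ℝ] ℂ, (∀ v, L v = (g.1 * slTraceless n v) i j) ∧
      HasFDerivAt (fun x : SLModel n => ((slChart g).symm x).1 i j) L
        (slCoord (1 : Matrix (Fin n) (Fin n) ℂ)) := by
  obtain ⟨L, hL, hL'⟩ := exists_hasFDerivAt_slFill_slCorner n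
  have h1 := HasFDerivAt.fun_sum (u := Finset.univ) fun (k : Fin n) _ =>
    (hasFDerivAt_pi'.1 (hasFDerivAt_pi'.1 hL' k) j).const_mul (g.1 i k)
  refine ⟨_, fun v => ?_, h1.congr_of_eventuallyEq ?_⟩
  · simp [Matrix.mul_apply, hL]
  · filter_upwards [isOpen_slCofactor.mem_nhds (slCofactor_slCoord_one (n := n))] with x hx
    exact slChart_symm_entry g hx i j

theorem extChartAt_sl_self (g : SpecialLinearGroup (Fin n) ℂ) :
    extChartAt 𝓘(ℝ, SLModel n) g g = slCoord (1 : Matrix (Fin n) (Fin n) ℂ) := by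
  change slCoord (g⁻¹ * g).1 = _
  rw [inv_mul_cancel]
  rfl

/-- In the charts given by left translation, the derivative of a matrix entry on `SL(n, ℂ)`. -/
theorem mfderiv_sl_entry (g : SpecialLinearGroup (Fin n) ℂ) (i j : Fin n) (v : SLModel n) :
    (mfderiv 𝓘(ℝ, SLModel n) 𝓘(ℝ, ℂ) (fun g : SpecialLinearGroup (Fin n) ℂ => g.1 i j) g v : ℂ) =
      (g.1 * slTraceless n v) i j := by
  obtain ⟨L, hL, hL'⟩ := exists_hasFDerivAt_slChart_symm g i j
  have h1 : MDifferentiableAt 𝓘(ℝ, SLModel n) 𝓘(ℝ, ℂ)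
      (fun g : SpecialLinearGroup (Fin n) ℂ => g.1 i j) g :=
    (contMDiff_sl_entry i j g).mdifferentiableAt (by simp)
  rw [h1.mfderiv, ← hL v, extChartAt_sl_self, modelWithCornersSelf_coe, Set.range_id,
    fderivWithin_univ]
  exact DFunLike.congr_fun (HasFDerivAt.fderiv hL') v

theorem slTangentMatrix_eq (v : SLModel n) : slTangentMatrix v = slTraceless n v := by
  ext i j
  refine (mfderiv_sl_entry 1 i j v).trans ?_
  exact congrFun (congrFun (one_mul (slTraceless n v)) i) j

/-- In the charts given by left translation, the derivatives of left translations are trivial. -/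
theorem mfderiv_sl_mul_left (g x : SpecialLinearGroup (Fin n) ℂ) (v : SLModel n) :
    (mfderiv 𝓘(ℝ, SLModel n) 𝓘(ℝ, SLModel n)
      (fun y : SpecialLinearGroup (Fin n) ℂ => g * y) x v : SLModel n) = v := by
  have h1 : MDifferentiableAt 𝓘(ℝ, SLModel n) 𝓘(ℝ, SLModel n)
      (fun y : SpecialLinearGroup (Fin n) ℂ => g * y) x :=
    (contMDiff_mul_left (I := 𝓘(ℝ, SLModel n)) (n := ∞) (a := g) x).mdifferentiableAt (by simp)
  rw [h1.mfderiv, extChartAt_sl_self, modelWithCornersSelf_coe, Set.range_id, fderivWithin_univ]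
  have h2 : writtenInExtChartAt 𝓘(ℝ, SLModel n) 𝓘(ℝ, SLModel n) x (fun y => g * y)
      =ᶠ[nhds (slCoord (1 : Matrix (Fin n) (Fin n) ℂ))] id := by
    filter_upwards [isOpen_slCofactor.mem_nhds (slCofactor_slCoord_one (n := n))] with y hy
    have h3 : (slChart x) ((slChart x).symm y) = y :=
      (slChart x).right_inv (by rw [slChart_target]; exact hy)
    change slCoord ((g * x)⁻¹ * (g * (slChart x).symm y)).1 = y
    rw [_root_.mul_inv_rev, mul_assoc, inv_mul_cancel_left]
    exact h3
  rw [h2.fderiv_eq, fderiv_id]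
  rfl

/-- The trivialization of the tangent bundle around `h`, in terms of matrices. -/
theorem trivializationAt_sl (h g : SpecialLinearGroup (Fin n) ℂ) (v : SLModel n) :
    (trivializationAt (SLModel n) (TangentSpace 𝓘(ℝ, SLModel n)) h
      (⟨g, v⟩ : TangentBundle 𝓘(ℝ, SLModel n) (SpecialLinearGroup (Fin n) ℂ))).2 =
      slCoord ((h⁻¹).1 * (g.1 * slTraceless n v)) := by
  have hL := fun i j => exists_hasFDerivAt_slChart_symm g i j
  choose L hL hL' using hL
  rw [TangentBundle.trivializationAt_apply]
  change fderivWithin ℝ (fun y => slCoord ((h⁻¹).1 * ((slChart g).symm y).1))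
    (Set.range 𝓘(ℝ, SLModel n)) (slCoord (g⁻¹ * g).1) v = _
  have h0 : (g⁻¹ * g).1 = 1 := by
    rw [inv_mul_cancel]
    rfl
  rw [h0, modelWithCornersSelf_coe, Set.range_id, fderivWithin_univ]
  ext p
  have h1 : HasFDerivAt (fun y => slCoord ((h⁻¹).1 * ((slChart g).symm y).1))
      (ContinuousLinearMap.pi fun p => ∑ k, (h⁻¹).1 p.1.1 k • L k p.1.2)
      (slCoord (1 : Matrix (Fin n) (Fin n) ℂ)) := by
    refine hasFDerivAt_pi.2 fun p => ?_
    exact HasFDerivAt.fun_sum (u := Finset.univ) fun k _ =>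
      (hL' k p.1.2).const_mul ((h⁻¹).1 p.1.1 k)
  rw [h1.fderiv]
  simp [slCoord, Matrix.mul_apply, hL]

end SLTangent

section SLInvariant

open Matrix

variable {n : ℕ}

theorem contMDiffAt_matrix_mul {E' : Type*} [NormedAddCommGroup E'] [NormedSpace ℝ E']
    {H' : Type*} [TopologicalSpace H'] {I' : ModelWithCorners ℝ E' H'}
    {N : Type*} [TopologicalSpace N] [ChartedSpace H' N] {A B : N → Matrix (Fin n) (Fin n) ℂ}
    {x : N} (hA : ∀ i j, ContMDiffAt I' 𝓘(ℝ, ℂ) ∞ (fun y => A y i j) x)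
    (hB : ∀ i j, ContMDiffAt I' 𝓘(ℝ, ℂ) ∞ (fun y => B y i j) x) (i j : Fin n) :
    ContMDiffAt I' 𝓘(ℝ, ℂ) ∞ (fun y => (A y * B y) i j) x := by
  simp only [Matrix.mul_apply]
  exact ContMDiffAt.sum fun k _ => contMDiffAt_mul_complex (hA i k) (hB k j)

/-- The matrix entries of `slTraceless` as continuous linear functions. -/
def slTracelessEntry (i j : Fin n) : SLModel n →L[ℝ] ℂ :=
  LinearMap.toContinuousLinearMap
    { toFun := fun v => slTraceless n v i j
      map_add' := fun v w => by rw [map_add]; rfl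
      map_smul' := fun c v => by rw [map_smul]; rfl }

/-- In the charts given by left translation, a map into the tangent bundle of `SL(n, ℂ)` is smooth
if its two components are. -/
theorem contMDiff_sl_tangent {E' : Type*} [NormedAddCommGroup E'] [NormedSpace ℝ E']
    {H' : Type*} [TopologicalSpace H'] {I' : ModelWithCorners ℝ E' H'}
    {N : Type*} [TopologicalSpace N] [ChartedSpace H' N] {f : N → SpecialLinearGroup (Fin n) ℂ}
    {u : N → SLModel n} (hf : ContMDiff I' 𝓘(ℝ, SLModel n) ∞ f)
    (hu : ContMDiff I' 𝓘(ℝ, SLModel n) ∞ u) :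
    ContMDiff I' (𝓘(ℝ, SLModel n)).tangent ∞
      (fun y => (⟨f y, u y⟩ : TangentBundle 𝓘(ℝ, SLModel n) (SpecialLinearGroup (Fin n) ℂ))) := by
  intro x
  refine Bundle.contMDiffAt_totalSpace.2 ⟨hf x, ?_⟩
  simp only [trivializationAt_sl]
  refine contMDiffAt_pi_space.2 fun p => ?_
  have h' : ∀ i j, ContMDiffAt I' 𝓘(ℝ, ℂ) ∞ (fun y => (f y).1 i j) x := fun i j =>
    ((contMDiff_sl_entry i j).comp hf) x
  have hu' : ∀ i j, ContMDiffAt I' 𝓘(ℝ, ℂ) ∞ (fun y => slTraceless n (u y) i j) x := fun i j =>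
    ((slTracelessEntry i j).contDiff (n := ∞)).contMDiff.contMDiffAt.comp x (hu x)
  exact contMDiffAt_matrix_mul (A := fun _ => ((f x)⁻¹).1) (fun _ _ => contMDiffAt_const)
    (contMDiffAt_matrix_mul h' hu') p.1.1 p.1.2

/-- In the charts given by left translation, the fibre component is a smooth function on the tangent
bundle of `SL(n, ℂ)`. -/
theorem contMDiff_sl_tangent_snd :
    ContMDiff (𝓘(ℝ, SLModel n)).tangent 𝓘(ℝ, SLModel n) ∞
      (fun v : TangentBundle 𝓘(ℝ, SLModel n) (SpecialLinearGroup (Fin n) ℂ) =>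
        (v.2 : SLModel n)) := by
  have h1 : ∀ i j, ContMDiff (𝓘(ℝ, SLModel n)).tangent 𝓘(ℝ, ℂ) ∞
      (fun v : TangentBundle 𝓘(ℝ, SLModel n) (SpecialLinearGroup (Fin n) ℂ) =>
        (v.1.1 * slTraceless n v.2) i j) := by
    intro i j
    have h2 := (contMDiff_snd_tangentBundle_modelSpace (n := ∞) ℂ 𝓘(ℝ, ℂ)).comp
      ((contMDiff_sl_entry (n := n) i j).contMDiff_tangentMap (m := ∞) (by simp))
    refine h2.congr fun v => ?_
    exact (mfderiv_sl_entry v.1 i j v.2).symm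
  have h3 : ∀ v : TangentBundle 𝓘(ℝ, SLModel n) (SpecialLinearGroup (Fin n) ℂ),
      (v.2 : SLModel n) = slCoord ((v.1⁻¹).1 * (v.1.1 * slTraceless n v.2)) := by
    intro v
    have h4 : (v.1⁻¹).1 * v.1.1 = 1 := by
      have := congrArg Subtype.val (inv_mul_cancel v.1)
      exact this
    rw [← mul_assoc, h4, one_mul]
    exact (slCoord_slTraceless (n := n) v.2).symm
  refine ContMDiff.congr ?_ h3
  intro x
  refine contMDiffAt_pi_space.2 fun p => ?_
  refine contMDiffAt_matrix_mul (fun i j => ?_) (fun i j => h1 i j x) p.1.1 p.1.2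
  exact ((contMDiff_sl_entry i j).comp ((contMDiff_inv 𝓘(ℝ, SLModel n) ∞).comp
    (Bundle.contMDiff_proj (TangentSpace 𝓘(ℝ, SLModel n))))) x

/-- The left invariant fibrewise linear map given by `k` in the charts given by left translation. -/
def slEndo (k : SLModel n →L[ℝ] SLModel n) :
    TangentEndo 𝓘(ℝ, SLModel n) (SpecialLinearGroup (Fin n) ℂ) := fun _ => k

theorem slEndo_isLeftInvariant (k : SLModel n →L[ℝ] SLModel n) : (slEndo k).IsLeftInvariant := by
  intro g x v
  refine (mfderiv_sl_mul_left g x (k v)).trans ?_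
  exact (congrArg k (mfderiv_sl_mul_left g x v)).symm

theorem slEndo_isSmooth (k : SLModel n →L[ℝ] SLModel n) : (slEndo k).IsSmooth :=
  contMDiff_sl_tangent (Bundle.contMDiff_proj (TangentSpace 𝓘(ℝ, SLModel n)))
    (k.contMDiff.comp contMDiff_sl_tangent_snd)

theorem two_le_infty : (2 : WithTop ℕ∞) ≤ ∞ := WithTop.coe_le_coe.2 (le_top : (2 : ℕ∞) ≤ ⊤)

theorem mfderiv_extChartAt_self_sl (x : SpecialLinearGroup (Fin n) ℂ) :
    mfderiv 𝓘(ℝ, SLModel n) 𝓘(ℝ, SLModel n) (extChartAt 𝓘(ℝ, SLModel n) x) x =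
      ContinuousLinearMap.id ℝ (SLModel n) := by
  have h1 : MDifferentiableAt 𝓘(ℝ, SLModel n) 𝓘(ℝ, SLModel n)
      (extChartAt 𝓘(ℝ, SLModel n) x) x :=
    (contMDiffAt_extChartAt (n := ∞)).mdifferentiableAt (by simp)
  rw [h1.mfderiv, extChartAt_sl_self, modelWithCornersSelf_coe, Set.range_id, fderivWithin_univ]
  have h2 : writtenInExtChartAt 𝓘(ℝ, SLModel n) 𝓘(ℝ, SLModel n) x
      (extChartAt 𝓘(ℝ, SLModel n) x) =ᶠ[nhds (slCoord (1 : Matrix (Fin n) (Fin n) ℂ))] id := by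
    filter_upwards [isOpen_slCofactor.mem_nhds (slCofactor_slCoord_one (n := n))] with y hy
    exact (slChart x).right_inv (by rw [slChart_target]; exact hy)
  rw [h2.fderiv_eq, fderiv_id]

theorem slChart_symm_slCoord_one (x : SpecialLinearGroup (Fin n) ℂ) :
    (slChart x).symm (slCoord (1 : Matrix (Fin n) (Fin n) ℂ)) = x := by
  rw [← extChartAt_sl_self x]
  exact extChartAt_to_inv (I := 𝓘(ℝ, SLModel n)) x

theorem contDiffAt_slChart_symm_entry (x : SpecialLinearGroup (Fin n) ℂ) (i j : Fin n) :
    ContDiffAt ℝ ∞ (fun y : SLModel n => ((slChart x).symm y).1 i j)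
      (slCoord (1 : Matrix (Fin n) (Fin n) ℂ)) :=
  (contDiffOn_slChart_symm_entry x i j).contDiffAt (by
    rw [slChart_target]
    exact isOpen_slCofactor.mem_nhds slCofactor_slCoord_one)

/-- A vector field on `SL(n, ℂ)`, in the chart around `x`. -/
def slPullback (x : SpecialLinearGroup (Fin n) ℂ) (X : ∀ x : SpecialLinearGroup (Fin n) ℂ,
    TangentSpace 𝓘(ℝ, SLModel n) x) : SLModel n → SLModel n :=
  VectorField.mpullback 𝓘(ℝ, SLModel n) 𝓘(ℝ, SLModel n) (extChartAt 𝓘(ℝ, SLModel n) x).symm X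

theorem differentiableAt_slPullback (x : SpecialLinearGroup (Fin n) ℂ)
    {X : ∀ x : SpecialLinearGroup (Fin n) ℂ, TangentSpace 𝓘(ℝ, SLModel n) x}
    (hX : IsSmoothVectorField X) :
    DifferentiableAt ℝ (slPullback x X) (slCoord (1 : Matrix (Fin n) (Fin n) ℂ)) := by
  have : IsManifold 𝓘(ℝ, SLModel n) 2 (SpecialLinearGroup (Fin n) ℂ) :=
    IsManifold.of_le (n := ∞) two_le_infty
  have h1 : MDifferentiableWithinAt 𝓘(ℝ, SLModel n) (𝓘(ℝ, SLModel n)).tangent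
      (fun y => (⟨y, X y⟩ : TangentBundle 𝓘(ℝ, SLModel n) (SpecialLinearGroup (Fin n) ℂ)))
      Set.univ x := ((hX x).mdifferentiableAt (by simp)).mdifferentiableWithinAt
  have h2 := h1.differentiableWithinAt_mpullbackWithin_vectorField
  rw [extChartAt_sl_self, modelWithCornersSelf_coe, Set.range_id, Set.preimage_univ,
    Set.univ_inter, VectorField.mpullbackWithin_univ] at h2
  exact differentiableWithinAt_univ.1 h2

theorem mlieBracket_eq_lieBracket_slPullback (x : SpecialLinearGroup (Fin n) ℂ)
    (X Y : ∀ x : SpecialLinearGroup (Fin n) ℂ, TangentSpace 𝓘(ℝ, SLModel n) x) :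
    (VectorField.mlieBracket 𝓘(ℝ, SLModel n) X Y x : SLModel n) =
      VectorField.lieBracket ℝ (slPullback x X) (slPullback x Y)
        (slCoord (1 : Matrix (Fin n) (Fin n) ℂ)) := by
  rw [← VectorField.mlieBracketWithin_univ, VectorField.mlieBracketWithin_apply,
    mfderiv_extChartAt_self_sl, extChartAt_sl_self, modelWithCornersSelf_coe, Set.range_id,
    Set.preimage_univ, Set.univ_inter, VectorField.mpullbackWithin_univ,
    VectorField.mpullbackWithin_univ]
  refine (congrFun (congrArg DFunLike.coe
    (ContinuousLinearMap.inverse_id (R := ℝ) (M := SLModel n))) _).trans ?_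
  exact congrFun (VectorField.lieBracketWithin_univ (𝕜 := ℝ) (V := slPullback x X)
    (W := slPullback x Y)) _

theorem fderiv_entry_slPullback (x : SpecialLinearGroup (Fin n) ℂ)
    (X : ∀ x : SpecialLinearGroup (Fin n) ℂ, TangentSpace 𝓘(ℝ, SLModel n) x) {y : SLModel n}
    (hy : slCofactor y ≠ 0) (i j : Fin n) :
    fderiv ℝ (fun y : SLModel n => ((slChart x).symm y).1 i j) y (slPullback x X y) =
      (((slChart x).symm y).1 * slTraceless n (X ((slChart x).symm y))) i j := by
  have hy' : y ∈ (extChartAt 𝓘(ℝ, SLModel n) x).target := by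
    rw [extChartAt_target]
    simp only [modelWithCornersSelf_coe_symm, modelWithCornersSelf_coe, Set.range_id,
      Set.inter_univ, Set.preimage_id]
    exact (slChart_target x).symm ▸ hy
  have hinv := isInvertible_mfderivWithin_extChartAt_symm (I := 𝓘(ℝ, SLModel n)) hy'
  rw [modelWithCornersSelf_coe, Set.range_id, mfderivWithin_univ] at hinv
  have hd : MDifferentiableAt 𝓘(ℝ, SLModel n) 𝓘(ℝ, SLModel n)
      (extChartAt 𝓘(ℝ, SLModel n) x).symm y := by
    have := (contMDiffWithinAt_extChartAt_symm_range (I := 𝓘(ℝ, SLModel n)) (n := ∞) x hy')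
    rw [modelWithCornersSelf_coe, Set.range_id, contMDiffWithinAt_univ] at this
    exact this.mdifferentiableAt (by simp)
  have hf : MDifferentiableAt 𝓘(ℝ, SLModel n) 𝓘(ℝ, ℂ)
      (fun g : SpecialLinearGroup (Fin n) ℂ => g.1 i j)
      ((extChartAt 𝓘(ℝ, SLModel n) x).symm y) :=
    (contMDiff_sl_entry i j _).mdifferentiableAt (by simp)
  have hcomp := mfderiv_comp y hf hd
  rw [mfderiv_eq_fderiv] at hcomp
  refine (DFunLike.congr_fun hcomp (slPullback x X y)).trans ?_
  refine Eq.trans ?_ (mfderiv_sl_entry ((slChart x).symm y) i j (X ((slChart x).symm y)))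
  refine congrArg (mfderiv 𝓘(ℝ, SLModel n) 𝓘(ℝ, ℂ)
      (fun g : SpecialLinearGroup (Fin n) ℂ => g.1 i j) ((slChart x).symm y)) ?_
  exact hinv.self_apply_inverse _

theorem differentiableAt_comp_slChart_symm (x : SpecialLinearGroup (Fin n) ℂ)
    {X : ∀ x : SpecialLinearGroup (Fin n) ℂ, TangentSpace 𝓘(ℝ, SLModel n) x}
    (hX : IsSmoothVectorField X) :
    DifferentiableAt ℝ (fun y => (X ((slChart x).symm y) : SLModel n))
      (slCoord (1 : Matrix (Fin n) (Fin n) ℂ)) := by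
  have h1 : ContMDiffAt 𝓘(ℝ, SLModel n) 𝓘(ℝ, SLModel n) ∞
      (extChartAt 𝓘(ℝ, SLModel n) x).symm (slCoord (1 : Matrix (Fin n) (Fin n) ℂ)) := by
    have := contMDiffWithinAt_extChartAt_symm_range_self (I := 𝓘(ℝ, SLModel n)) (n := ∞) x
    rwa [modelWithCornersSelf_coe, Set.range_id, contMDiffWithinAt_univ, extChartAt_sl_self]
      at this
  have h2 := (contMDiff_sl_tangent_snd.comp hX).contMDiffAt.comp _ h1
  exact h2.contDiffAt.differentiableAt (by simp)

theorem fderiv_fderiv_entry_slPullback (x : SpecialLinearGroup (Fin n) ℂ)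
    {X : ∀ x : SpecialLinearGroup (Fin n) ℂ, TangentSpace 𝓘(ℝ, SLModel n) x}
    (hX : IsSmoothVectorField X) (v : SLModel n) (i j : Fin n) :
    fderiv ℝ (fun y => fderiv ℝ (fun y : SLModel n => ((slChart x).symm y).1 i j) y
      (slPullback x X y)) (slCoord (1 : Matrix (Fin n) (Fin n) ℂ)) v =
      (x.1 * (slTraceless n v * slTraceless n (X x) + slTraceless n
        (fderiv ℝ (fun y => (X ((slChart x).symm y) : SLModel n))
          (slCoord (1 : Matrix (Fin n) (Fin n) ℂ)) v))) i j := by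
  have h1 : (fun y => fderiv ℝ (fun y : SLModel n => ((slChart x).symm y).1 i j) y
      (slPullback x X y)) =ᶠ[nhds (slCoord (1 : Matrix (Fin n) (Fin n) ℂ))]
      fun y => ∑ k, ((slChart x).symm y).1 i k * slTracelessEntry k j (X ((slChart x).symm y)) := by
    filter_upwards [isOpen_slCofactor.mem_nhds (slCofactor_slCoord_one (n := n))] with y hy
    exact (fderiv_entry_slPullback x X hy i j).trans Matrix.mul_apply
  choose L hL hL' using fun i j => exists_hasFDerivAt_slChart_symm x i j
  have h2 := HasFDerivAt.fun_sum (u := Finset.univ) fun (k : Fin n) _ =>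
    (hL' i k).mul ((slTracelessEntry k j).hasFDerivAt.comp (slCoord (1 : Matrix (Fin n) (Fin n) ℂ))
      (differentiableAt_comp_slChart_symm x hX).hasFDerivAt)
  have h3 : ∀ k, slTracelessEntry k j (X ((slChart x).symm (slCoord 1))) =
      slTraceless n (X x) k j := by
    intro k
    rw [slChart_symm_slCoord_one]
    rfl
  rw [h1.fderiv_eq]
  refine (DFunLike.congr_fun (HasFDerivAt.fderiv h2) v).trans ?_
  rw [mul_add, ← mul_assoc, Matrix.add_apply, Matrix.mul_apply, Matrix.mul_apply,
    ← Finset.sum_add_distrib]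
  simp only [_root_.sum_apply]
  refine Finset.sum_congr rfl fun k _ => ?_
  simp only [_root_.add_apply, _root_.smul_apply, smul_eq_mul, hL, slChart_symm_slCoord_one]
  have h4 : (slTracelessEntry k j ∘ fun y => (X ((slChart x).symm y) : SLModel n))
      (slCoord (1 : Matrix (Fin n) (Fin n) ℂ)) = slTraceless n (X x) k j := h3 k
  rw [h4, add_comm, mul_comm (slTraceless n (X x) k j)]
  rfl

/-- The bracket of vector fields on `SL(n, ℂ)`, in the charts given by left translation. -/
theorem slTraceless_mlieBracket {X Y : ∀ x : SpecialLinearGroup (Fin n) ℂ,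
    TangentSpace 𝓘(ℝ, SLModel n) x} (hX : IsSmoothVectorField X) (hY : IsSmoothVectorField Y)
    (x : SpecialLinearGroup (Fin n) ℂ) :
    slTraceless n (VectorField.mlieBracket 𝓘(ℝ, SLModel n) X Y x) =
      ⁅slTraceless n (X x), slTraceless n (Y x)⁆ +
      slTraceless n (fderiv ℝ (fun y => (Y ((slChart x).symm y) : SLModel n))
        (slCoord (1 : Matrix (Fin n) (Fin n) ℂ)) (X x)) -
      slTraceless n (fderiv ℝ (fun y => (X ((slChart x).symm y) : SLModel n))
        (slCoord (1 : Matrix (Fin n) (Fin n) ℂ)) (Y x)) := by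
  have hinj : ∀ A B : Matrix (Fin n) (Fin n) ℂ, x.1 * A = x.1 * B → A = B := by
    intro A B h
    have h4 : (x⁻¹).1 * x.1 = 1 := congrArg Subtype.val (inv_mul_cancel x)
    rw [← one_mul A, ← h4, mul_assoc, h, ← mul_assoc, h4, one_mul]
  have hpull : ∀ X : ∀ x : SpecialLinearGroup (Fin n) ℂ, TangentSpace 𝓘(ℝ, SLModel n) x,
      slPullback x X (slCoord (1 : Matrix (Fin n) (Fin n) ℂ)) = X x := by
    intro X
    apply slTraceless_injective
    apply hinj
    ext i j
    obtain ⟨L, hL, hL'⟩ := exists_hasFDerivAt_slChart_symm x i j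
    have h1 := fderiv_entry_slPullback x X (slCofactor_slCoord_one (n := n)) i j
    rw [hL'.fderiv, hL, slChart_symm_slCoord_one] at h1
    exact h1
  apply hinj
  ext i j
  obtain ⟨L, hL, hL'⟩ := exists_hasFDerivAt_slChart_symm x i j
  have h1 := VectorField.fderiv_apply_lieBracket (contDiffAt_slChart_symm_entry x i j)
    (by rw [minSmoothness_of_isRCLikeNormedField]; exact two_le_infty)
    (differentiableAt_slPullback x hY) (differentiableAt_slPullback x hX)
  rw [fderiv_fderiv_entry_slPullback x hX, fderiv_fderiv_entry_slPullback x hY, hpull, hpull,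
    hL'.fderiv, hL] at h1
  refine Eq.trans ?_ (h1.trans ?_)
  · rw [← mlieBracket_eq_lieBracket_slPullback]
  · rw [← Matrix.sub_apply, ← mul_sub]
    refine congrArg (fun Z : Matrix (Fin n) (Fin n) ℂ => (x.1 * Z) i j) ?_
    rw [Ring.lie_def]
    have h2 : ∀ A B C D : Matrix (Fin n) (Fin n) ℂ, A + B - (C + D) = A - C + B - D := by
      intros
      abel
    exact h2 _ _ _ _

end SLInvariant

section SLOp

open Matrix

variable {n : ℕ}

/-- The operator on the model space induced by an operator on the traceless matrices. -/
def slOp (K : Matrix (Fin n) (Fin n) ℂ →ₗ[ℂ] Matrix (Fin n) (Fin n) ℂ) :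
    SLModel n →L[ℝ] SLModel n :=
  LinearMap.toContinuousLinearMap
    { toFun := fun v => slCoord (K (slTraceless n v))
      map_add' := fun v w => by rw [map_add, map_add]; rfl
      map_smul' := fun c v => by
        rw [map_smul, ← Complex.coe_smul, map_smul, Complex.coe_smul]; rfl }

theorem slTraceless_slOp {K : Matrix (Fin n) (Fin n) ℂ →ₗ[ℂ] Matrix (Fin n) (Fin n) ℂ}
    (hK : ∀ X, (K X).trace = 0) (v : SLModel n) :
    slTraceless n (slOp K v) = K (slTraceless n v) :=
  slTraceless_slCoord (hK _)

/-- The value of a vector field, in the charts given by left translation. -/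
def slValue (x : SpecialLinearGroup (Fin n) ℂ) (X : ∀ x : SpecialLinearGroup (Fin n) ℂ,
    TangentSpace 𝓘(ℝ, SLModel n) x) : SLModel n := X x

/-- The bracket of vector fields, in the charts given by left translation. -/
def slBracket (x : SpecialLinearGroup (Fin n) ℂ) (X Y : ∀ x : SpecialLinearGroup (Fin n) ℂ,
    TangentSpace 𝓘(ℝ, SLModel n) x) : SLModel n :=
  VectorField.mlieBracket 𝓘(ℝ, SLModel n) X Y x

/-- The derivative of a vector field with respect to the left invariant trivialization of the
tangent bundle. -/
def slDeriv (x : SpecialLinearGroup (Fin n) ℂ) (X : ∀ x : SpecialLinearGroup (Fin n) ℂ,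
    TangentSpace 𝓘(ℝ, SLModel n) x) (v : SLModel n) : Matrix (Fin n) (Fin n) ℂ :=
  slTraceless n (fderiv ℝ (fun y => (X ((slChart x).symm y) : SLModel n))
    (slCoord (1 : Matrix (Fin n) (Fin n) ℂ)) v)

theorem trace_slDeriv (x : SpecialLinearGroup (Fin n) ℂ)
    (X : ∀ x : SpecialLinearGroup (Fin n) ℂ, TangentSpace 𝓘(ℝ, SLModel n) x) (v : SLModel n) :
    (slDeriv x X v).trace = 0 := trace_slTraceless _

theorem slTraceless_slBracket {X Y : ∀ x : SpecialLinearGroup (Fin n) ℂ,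
    TangentSpace 𝓘(ℝ, SLModel n) x} (hX : IsSmoothVectorField X) (hY : IsSmoothVectorField Y)
    (x : SpecialLinearGroup (Fin n) ℂ) :
    slTraceless n (slBracket x X Y) =
      ⁅slTraceless n (slValue x X), slTraceless n (slValue x Y)⁆ +
      slDeriv x Y (slValue x X) - slDeriv x X (slValue x Y) :=
  slTraceless_mlieBracket hX hY x

/-- The Nijenhuis expression of a left invariant operator vanishes if it does so on the traceless
matrices. -/
theorem nijenhuis_slEndo_slOp {K : Matrix (Fin n) (Fin n) ℂ →ₗ[ℂ] Matrix (Fin n) (Fin n) ℂ}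
    (hK : ∀ X, (K X).trace = 0) {ε : ℝ} (hsq : ∀ X, X.trace = 0 → K (K X) = ε • X)
    (hN : ∀ X Y, X.trace = 0 → Y.trace = 0 →
      ⁅K X, K Y⁆ + ε • ⁅X, Y⁆ - K ⁅K X, Y⁆ - K ⁅X, K Y⁆ = 0)
    {X Y : ∀ x : SpecialLinearGroup (Fin n) ℂ, TangentSpace 𝓘(ℝ, SLModel n) x}
    (hX : IsSmoothVectorField X) (hY : IsSmoothVectorField Y) (x : SpecialLinearGroup (Fin n) ℂ) :
    (slEndo (slOp K)).nijenhuis ε X Y x = 0 := by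
  have hA : ∀ Z : ∀ x : SpecialLinearGroup (Fin n) ℂ, TangentSpace 𝓘(ℝ, SLModel n) x,
      IsSmoothVectorField Z → IsSmoothVectorField fun y => slEndo (slOp K) y (Z y) := fun Z hZ =>
    (slEndo_isSmooth (slOp K)).comp hZ
  have hd : ∀ Z : ∀ x : SpecialLinearGroup (Fin n) ℂ, TangentSpace 𝓘(ℝ, SLModel n) x,
      IsSmoothVectorField Z → ∀ v : SLModel n,
      slDeriv x (fun y => slEndo (slOp K) y (Z y)) v = K (slDeriv x Z v) := by
    intro Z hZ v
    have h1 := (slOp K).hasFDerivAt.comp (slCoord (1 : Matrix (Fin n) (Fin n) ℂ))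
      (differentiableAt_comp_slChart_symm x hZ).hasFDerivAt
    rw [slDeriv, slDeriv, ← slTraceless_slOp hK]
    exact congrArg (slTraceless n) (DFunLike.congr_fun h1.fderiv v)
  have hV : ∀ Z : ∀ x : SpecialLinearGroup (Fin n) ℂ, TangentSpace 𝓘(ℝ, SLModel n) x,
      slTraceless n (slValue x fun y => slEndo (slOp K) y (Z y)) =
        K (slTraceless n (slValue x Z)) := fun Z => slTraceless_slOp hK _
  have h1 := slTraceless_slBracket (hA X hX) (hA Y hY) x
  have h2 := slTraceless_slBracket hX hY x
  have h3 := slTraceless_slBracket (hA X hX) hY x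
  have h4 := slTraceless_slBracket hX (hA Y hY) x
  rw [hd X hX, hd Y hY, hV, hV] at h1
  rw [hd X hX, hV] at h3
  rw [hd Y hY, hV] at h4
  apply slTraceless_injective
  have h5 : slTraceless n ((slEndo (slOp K)).nijenhuis ε X Y x) =
      slTraceless n (slBracket x (fun y => slEndo (slOp K) y (X y))
        (fun y => slEndo (slOp K) y (Y y))) + ε • slTraceless n (slBracket x X Y) -
      K (slTraceless n (slBracket x (fun y => slEndo (slOp K) y (X y)) Y)) -
      K (slTraceless n (slBracket x X (fun y => slEndo (slOp K) y (Y y)))) := by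
    rw [← slTraceless_slOp hK, ← slTraceless_slOp hK, ← map_smul, ← map_add, ← map_sub,
      ← map_sub]
    rfl
  refine (h5.trans ?_).trans (map_zero (slTraceless n)).symm
  rw [h1, h2, h3, h4, ← hN _ _ (trace_slTraceless (slValue x X)) (trace_slTraceless (slValue x Y))]
  simp only [map_add, map_sub, smul_add, smul_sub]
  rw [hsq _ (trace_slDeriv x Y _), hsq _ (trace_slDeriv x X _)]
  abel

theorem isComplexProductStructure_slEndo_slOp
    {P J : Matrix (Fin n) (Fin n) ℂ →ₗ[ℂ] Matrix (Fin n) (Fin n) ℂ}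
    (h : IsSLComplexProduct P J) :
    IsComplexProductStructure (slEndo (slOp P)) (slEndo (slOp J)) where
  product :=
    { smooth := slEndo_isSmooth _
      sq := fun x v => slTraceless_injective (((slTraceless_slOp h.trace_product _).trans
        (congrArg P (slTraceless_slOp h.trace_product _))).trans
        (h.product_sq _ (trace_slTraceless _)))
      trace_const := ⟨LinearMap.trace ℝ (SLModel n) (slOp P : SLModel n →ₗ[ℝ] SLModel n),
        fun _ => rfl⟩
      integrable := fun X Y hX hY x => nijenhuis_slEndo_slOp h.trace_product
        (fun X hX => by rw [h.product_sq X hX, one_smul])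
        (fun X Y hX hY => by rw [one_smul]; exact h.product_integrable X Y hX hY) hX hY x }
  complex :=
    { smooth := slEndo_isSmooth _
      sq := fun x v => slTraceless_injective ((((slTraceless_slOp h.trace_complex _).trans
        (congrArg J (slTraceless_slOp h.trace_complex _))).trans
        (h.complex_sq _ (trace_slTraceless _))).trans (map_neg (slTraceless n) _).symm)
      integrable := fun X Y hX hY x => nijenhuis_slEndo_slOp h.trace_complex
        (fun X hX => by rw [h.complex_sq X hX, neg_one_smul])
        (fun X Y hX hY => by
          rw [neg_one_smul, ← sub_eq_add_neg]
          exact h.complex_integrable X Y hX hY) hX hY x }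
  anticomm x v := by
    apply slTraceless_injective
    refine (((slTraceless_slOp h.trace_product _).trans
      (congrArg P (slTraceless_slOp h.trace_complex _))).trans (h.anticomm _)).trans ?_
    refine Eq.trans ?_ (map_neg (slTraceless n) _).symm
    exact congrArg Neg.neg ((slTraceless_slOp h.trace_complex _).trans
      (congrArg J (slTraceless_slOp h.trace_product _))).symm

/-- The restriction of a complex linear operator to an invariant real Lie subalgebra. -/
def restrictOp (𝔤 : LieSubalgebra ℝ (Matrix (Fin n) (Fin n) ℂ))
    (K : Matrix (Fin n) (Fin n) ℂ →ₗ[ℂ] Matrix (Fin n) (Fin n) ℂ) (hK : ∀ X ∈ 𝔤, K X ∈ 𝔤) :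
    𝔤 →ₗ[ℝ] 𝔤 where
  toFun X := ⟨K X, hK X X.2⟩
  map_add' X Y := Subtype.ext (map_add K _ _)
  map_smul' c X := Subtype.ext (by
    change K (c • (X : Matrix _ _ ℂ)) = c • K X
    rw [← Complex.coe_smul, map_smul, Complex.coe_smul])

theorem isComplexLinearExtension_slEndo_slOp (𝔤 : LieSubalgebra ℝ (Matrix (Fin n) (Fin n) ℂ))
    {K : Matrix (Fin n) (Fin n) ℂ →ₗ[ℂ] Matrix (Fin n) (Fin n) ℂ} (hK : ∀ X ∈ 𝔤, K X ∈ 𝔤)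
    (hK0 : ∀ X, (K X).trace = 0) :
    IsComplexLinearExtension 𝔤 (restrictOp 𝔤 K hK) (slEndo (slOp K)) := by
  intro v X Y hv
  refine ((slTangentMatrix_eq _).trans (slTraceless_slOp hK0 v)).trans ?_
  refine (congrArg K ((slTangentMatrix_eq v).symm.trans hv)).trans ?_
  rw [map_add, map_smul]
  rfl

theorem isLieComplexProductStructure_restrictOp {𝔤 : LieSubalgebra ℝ (Matrix (Fin n) (Fin n) ℂ)}
    (h𝔤 : ∀ X ∈ 𝔤, X.trace = 0)
    {P J : Matrix (Fin n) (Fin n) ℂ →ₗ[ℂ] Matrix (Fin n) (Fin n) ℂ}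
    (h : IsSLComplexProduct P J) (hP : ∀ X ∈ 𝔤, P X ∈ 𝔤) (hJ : ∀ X ∈ 𝔤, J X ∈ 𝔤) :
    IsLieComplexProductStructure (restrictOp 𝔤 P hP) (restrictOp 𝔤 J hJ) where
  product_sq X := Subtype.ext (h.product_sq X (h𝔤 X X.2))
  complex_sq X := Subtype.ext (h.complex_sq X (h𝔤 X X.2))
  anticomm X := Subtype.ext (h.anticomm X)
  product_integrable X Y := Subtype.ext (h.product_integrable X Y (h𝔤 X X.2) (h𝔤 Y Y.2))
  complex_integrable X Y := Subtype.ext (h.complex_integrable X Y (h𝔤 X X.2) (h𝔤 Y Y.2))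

end SLOp

end

theorem corollary1p2 (m : ℕ) (hm : 1 < m)
    (𝔤 : LieSubalgebra ℝ (Matrix (Fin (2 * m - 1)) (Fin (2 * m - 1)) ℂ))
    (h𝔤 : 𝔤 = slReal (2 * m - 1) ∨ 𝔤 = suIndefinite (2 * m - 1) m) :
    ∃ (P₀ J₀ : 𝔤 →ₗ[ℝ] 𝔤)
      (P J : TangentEndo 𝓘(ℝ, SLModel (2 * m - 1))
        (Matrix.SpecialLinearGroup (Fin (2 * m - 1)) ℂ)),
      IsLieComplexProductStructure P₀ J₀ ∧
      IsComplexProductStructure P J ∧ P.IsLeftInvariant ∧ J.IsLeftInvariant ∧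
      IsComplexLinearExtension 𝔤 P₀ P ∧ IsComplexLinearExtension 𝔤 J₀ J := by
  obtain ⟨P, J, h, hP, hJ⟩ := exists_isSLComplexProduct hm 𝔤 h𝔤
  have h0 : ∀ X ∈ 𝔤, X.trace = 0 := by
    rcases h𝔤 with rfl | rfl <;> exact fun X hX => hX.2
  exact ⟨restrictOp 𝔤 P hP, restrictOp 𝔤 J hJ, slEndo (slOp P), slEndo (slOp J),
    isLieComplexProductStructure_restrictOp h0 h hP hJ,
    isComplexProductStructure_slEndo_slOp h, slEndo_isLeftInvariant _, slEndo_isLeftInvariant _,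
    isComplexLinearExtension_slEndo_slOp 𝔤 hP h.trace_product,
    isComplexLinearExtension_slEndo_slOp 𝔤 hJ h.trace_complex⟩
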